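/- **Setting.** Let $n\ge 2$, let $M$ be an $n$-dimensional smooth manifold and let $\psi:M\to\mathbb R^{n+1}$ be a smooth immersion that is a *centroaffine hypersurface*, i.e. at each point the position vector $\psi$ is transversal to the tangent hyperplane. Let $D$ be the standard flat connection of $\mathbb R^{n+1}$. For $\varepsilon\in\{1,-1\}$, the Gauss formula $$D_X\psi_*(Y)=\psi_*(\nabla_XY)+h(X,Y)(-\varepsilon\psi)$$ defines the induced connection $\nabla$ and the centroaffine metric $h$. Assume that $\psi$ is *locally strongly convex*, i.e. $h$ is definite, and choose $\varepsilon$ such that $h$ is positive definite. Let $\hat\nabla$ be the Levi-Civita connection of $h$, $K(X,Y)=\nabla_XY-\hat\nabla_XY$ the difference tensor and $C=\nabla h$ the cubic form; the cubic form is *parallel* if $\hat\nabla C=0$. For a centroaffine hypersurface $\psi_1:M_1\to\mathbb R^{n}$ of dimension $n-1$ and a constant $\lambda\neq 0,-1$, the *Calabi product of $\psi_1$ and a point* is $$\tilde\psi:\mathbb R\times M_1\to\mathbb R^{n}\times\mathbb R,\qquad \tilde\psi(u,p)=(e^{u}\psi_1(p),\,e^{-\lambda u}).$$ **Theorem.**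 Assume that $\hat\nabla K=0$ and that there are $h$-orthogonal distributions $\mathcal D_1$ (of dimension $1$, spanned by a smooth unit vector field $T$) and $\mathcal D_2$ (of dimension $n-1$) on $M$ and real functions $\lambda_1,\lambda_2$ on $M$ (for instance constants) such that at every point $$K(T,T)=\lambda_1T,\qquad K(T,V)=\lambda_2V\quad\text{for all }V\in\mathcal D_2,\qquad \lambda_1\neq2\lambda_2 .$$ Then $\psi$ can be locally decomposed as the Calabi product of a locally strongly convex centroaffine hypersurface with parallel cubic form and a point. That is, for every $p_0\in M$ there are an open neighbourhood $U$ of $p_0$, an open interval $I$, an $(n-1)$-dimensional locally strongly convex centroaffine hypersurface $\psi_1:M_1\to\mathbb R^{n}$ with parallel cubic form ($M_1$ an open subset of $\mathbb R^{n-1}$), a constant $\lambda\neq0,-1$, a diffeomorphism $\Phi:U\to I\times M_1$ and a linear isomorphism $A:\mathbb R^{n+1}\to\mathbb R^{n}\times\mathbb R$ such that $$A\psi(q)=(e^{u}\psi_1(p),\,e^{-\lambda u})\qquad\text{for all }q\in U,\ (u,p)=\Phi(q).$$ -/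

import Mathlib

open scoped Manifold ContDiff

noncomputable section

namespace Centroaffine

/-! ### Centroaffine geometry of a parametrized hypersurface

Here `f : E → F` is a smooth map on an open subset of `E`, viewed as a hypersurface in coordinates.
Vectors `v : E` stand for the constant coefficient (coordinate) vector fields, so that
`D_v f_*(w)` is the second derivative of `f` in the directions `v, w`. -/

section Local

variable {E F : Type*} [NormedAddCommGroup E] [NormedSpace ℝ E]
  [NormedAddCommGroup F] [NormedSpace ℝ F]

/-- The map `(v, t) ↦ df_x(v) + t f(x)`; it is bijective iff `f` is a centroaffine hypersurface
immersion at `x`. -/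
def frame (f : E → F) (x : E) : (E × ℝ) →L[ℝ] F :=
  (fderiv ℝ f x).coprod (ContinuousLinearMap.toSpanSingleton ℝ (f x))

/-- The centroaffine metric `h` induced by the centroaffine normal `-ε f` (where `ε = ±1`), that is,
the second part of the Gauss formula `D_v f_*(w) = f_*(∇_v w) + h(v, w) (-ε f)`. -/
def metric (ε : ℝ) (f : E → F) (x : E) : E →L[ℝ] E →L[ℝ] ℝ :=
  (-ε) • (ContinuousLinearMap.compL ℝ E F ℝ
    ((ContinuousLinearMap.snd ℝ E ℝ).comp (frame f x).inverse)).comp (fderiv ℝ (fderiv ℝ f) x)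

/-- The Christoffel symbol of the induced connection: `∇_v w` for coordinate vector fields `v, w`,
that is, the first part of the Gauss formula. -/
def inducedConn (f : E → F) (x : E) : E →L[ℝ] E →L[ℝ] E :=
  (ContinuousLinearMap.compL ℝ E F E
    ((ContinuousLinearMap.fst ℝ E ℝ).comp (frame f x).inverse)).comp (fderiv ℝ (fderiv ℝ f) x)

/-- The Christoffel symbol of the Levi-Civita connection `∇̂` of `h`, for coordinate vector fields:
`2 h(∇̂_v w, z) = ∂_v h(w, z) + ∂_w h(v, z) - ∂_z h(v, w)`. -/
def leviCivita (ε : ℝ) (f : E → F) (x : E) (v w : E) : E :=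
  let Dh := fderiv ℝ (metric ε f) x
  (1 / 2 : ℝ) • (metric ε f x).inverse (Dh v w + Dh w v - (Dh.flip v).flip w)

/-- The difference tensor `K(v, w) = ∇_v w - ∇̂_v w`. -/
def diffTensor (ε : ℝ) (f : E → F) (x : E) (v w : E) : E :=
  inducedConn f x v w - leviCivita ε f x v w

/-- `(∇̂_z K)(v, w)`. -/
def covDerivDiffTensor (ε : ℝ) (f : E → F) (x : E) (z v w : E) : E :=
  fderiv ℝ (fun y => diffTensor ε f y v w) x z + leviCivita ε f x z (diffTensor ε f x v w)
    - diffTensor ε f x (leviCivita ε f x z v) w - diffTensor ε f x v (leviCivita ε f x z w)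

/-- The cubic form `C = ∇h`, that is `C(u, v, w) = (∇_u h)(v, w)`. -/
def cubicForm (ε : ℝ) (f : E → F) (x : E) (u v w : E) : ℝ :=
  fderiv ℝ (fun y => metric ε f y v w) x u
    - metric ε f x (inducedConn f x u v) w - metric ε f x v (inducedConn f x u w)

/-- `(∇̂_z C)(u, v, w)`. -/
def covDerivCubicForm (ε : ℝ) (f : E → F) (x : E) (z u v w : E) : ℝ :=
  fderiv ℝ (fun y => cubicForm ε f y u v w) x z
    - cubicForm ε f x (leviCivita ε f x z u) v w
    - cubicForm ε f x u (leviCivita ε f x z v) w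
    - cubicForm ε f x u v (leviCivita ε f x z w)

/-- On the open set `U`, `f` is a locally strongly convex centroaffine hypersurface, with `ε = ±1`
chosen such that the centroaffine metric `h` is positive definite: `f` is a smooth immersion, `F` is
the direct sum of the tangent hyperplane and the line of the position vector at each point, and `h`
is positive definite. -/
structure IsConvexCentroaffineOn (ε : ℝ) (f : E → F) (U : Set E) : Prop where
  eps : ε = 1 ∨ ε = -1
  smooth : ContDiffOn ℝ ∞ f U
  immersion : ∀ x ∈ U, Function.Injective (fderiv ℝ f x)
  ne_zero : ∀ x ∈ U, f x ≠ 0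
  transversal : ∀ x ∈ U, IsCompl (fderiv ℝ f x).range (Submodule.span ℝ {f x})
  posDef : ∀ x ∈ U, ∀ v : E, v ≠ 0 → 0 < metric ε f x v v

/-- The (generalized) Calabi product `(u, p) ↦ (e^u f(p), e^{-c u})` of `f` and a point. -/
def calabiPoint (c : ℝ) (f : E → F) (a : ℝ × E) : F × ℝ :=
  (Real.exp a.1 • f a.2, Real.exp (-c * a.1))

end Local

/-! ### Hypersurfaces `ψ : M → F` on a smooth manifold, through the charts of `M` -/

section Global

variable {n : ℕ} {M : Type*} [TopologicalSpace M] [ChartedSpace (EuclideanSpace ℝ (Fin n)) M]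
  {F : Type*} [NormedAddCommGroup F] [NormedSpace ℝ F]

/-- `ψ` in the coordinates of the chart around `p`. -/
def coordRep (ψ : M → F) (p : M) : EuclideanSpace ℝ (Fin n) → F :=
  ψ ∘ (extChartAt (𝓡 n) p).symm

/-- The components of a tangent vector at `q` in the coordinates of the chart around `p`. -/
def coordVec (p q : M) (v : TangentSpace (𝓡 n) q) : EuclideanSpace ℝ (Fin n) :=
  mfderiv (𝓡 n) 𝓘(ℝ, EuclideanSpace ℝ (Fin n)) (extChartAt (𝓡 n) p) q v

/-- `ψ : M → F` is a locally strongly convex centroaffine hypersurface, with `ε = ±1` chosen such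
that the centroaffine metric is positive definite. -/
def IsConvexCentroaffine (ε : ℝ) (ψ : M → F) : Prop :=
  (ε = 1 ∨ ε = -1) ∧
    ∀ p : M, IsConvexCentroaffineOn ε (coordRep ψ p) (extChartAt (𝓡 n) p).target

/-- `∇̂K = 0` on `M`. -/
def HasParallelDiffTensor (ε : ℝ) (ψ : M → F) : Prop :=
  ∀ p : M, ∀ x ∈ (extChartAt (𝓡 n) p).target, ∀ z v w : EuclideanSpace ℝ (Fin n),
    covDerivDiffTensor ε (coordRep ψ p) x z v w = 0

/-- The centroaffine metric of `ψ` at `q`, evaluated on tangent vectors of `M` at `q` in the chart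
around `p` (the value does not depend on `p`). -/
def metricAt (ε : ℝ) (ψ : M → F) (p q : M) (v w : TangentSpace (𝓡 n) q) : ℝ :=
  metric ε (coordRep ψ p) (extChartAt (𝓡 n) p q) (coordVec p q v) (coordVec p q w)

/-- The components, in the chart around `p`, of `K(v, w)` for tangent vectors `v, w` of `M`
at `q`. -/
def diffTensorAt (ε : ℝ) (ψ : M → F) (p q : M) (v w : TangentSpace (𝓡 n) q) :
    EuclideanSpace ℝ (Fin n) :=
  diffTensor ε (coordRep ψ p) (extChartAt (𝓡 n) p q) (coordVec p q v) (coordVec p q w)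

end Global

/-- Around `p₀`, the hypersurface `ψ : M → ℝⁿ⁺¹` is, up to a linear isomorphism of `ℝⁿ⁺¹` with
`ℝⁿ × ℝ` and a diffeomorphism `Φ` from a neighbourhood of `p₀` onto a product of an open interval and
an open subset `V` of `ℝⁿ⁻¹`, the Calabi product of a point and a locally strongly convex centroaffine
hypersurface `ψ₁ : V → ℝⁿ` with parallel cubic form. -/
def IsCalabiProductWithPointNear {n : ℕ} {M : Type*} [TopologicalSpace M]
    [ChartedSpace (EuclideanSpace ℝ (Fin n)) M]
    (ψ : M → EuclideanSpace ℝ (Fin (n + 1))) (p₀ : M) : Prop :=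
  ∃ (c ε₁ a b : ℝ) (V : Set (EuclideanSpace ℝ (Fin (n - 1))))
    (ψ₁ : EuclideanSpace ℝ (Fin (n - 1)) → EuclideanSpace ℝ (Fin n))
    (A : EuclideanSpace ℝ (Fin (n + 1)) ≃L[ℝ] (EuclideanSpace ℝ (Fin n) × ℝ))
    (Φ : OpenPartialHomeomorph M (ℝ × EuclideanSpace ℝ (Fin (n - 1)))),
    c ≠ 0 ∧ c ≠ -1 ∧
    IsOpen V ∧ IsConvexCentroaffineOn ε₁ ψ₁ V ∧
    (∀ x ∈ V, ∀ z u v w : EuclideanSpace ℝ (Fin (n - 1)),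
      covDerivCubicForm ε₁ ψ₁ x z u v w = 0) ∧
    p₀ ∈ Φ.source ∧ Φ.target = Set.Ioo a b ×ˢ V ∧
    ContMDiffOn (𝓡 n) 𝓘(ℝ, ℝ × EuclideanSpace ℝ (Fin (n - 1))) ∞ Φ Φ.source ∧
    ContMDiffOn 𝓘(ℝ, ℝ × EuclideanSpace ℝ (Fin (n - 1))) (𝓡 n) ∞ Φ.symm Φ.target ∧
    ∀ q ∈ Φ.source, A (ψ q) = calabiPoint c ψ₁ (Φ q)

end Centroaffine

end

/-!
Differentiating `K(T, T) = λ₁ T` and `K(T, V) = λ₂ V` with `∇̂K = 0` and `λ₁ ≠ 2 λ₂` shows that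
`∇̂T = 0` and that `λ₁ = a` and `λ₂ = b` are locally constant. The second derivatives of `ψ_*T` are
then known, and their symmetry gives `ε = b (a - b)`. It follows that the derivative of the vector
`w = (a - b) ψ_*T - ε ψ` is `(a - b) h(T, ·) w`, so `w` has a constant direction, and that `w`
satisfies the Gauss equation of `ψ`, so it is a linear image of `ψ`. This splits `ℝⁿ⁺¹` as `ℝⁿ × ℝ`,
where the last factor is spanned by `w` and the last component of `ψ` is `e^{(a - b) u / b}` for a
function `u` with `du = b h(T, ·)`. Along `T`, the first component is a constant times `e^u`,
hence it is determined by its restriction to the slice `u = 0`. The slice is totally geodesic, and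
the metric and the cubic form of the restriction are the restrictions of `|ε - b²| h` and
`|ε - b²| C`, whence the cubic form of the restriction is parallel.
-/

namespace Centroaffine

set_option maxSynthPendingDepth 3

/-! ### Differential calculus -/

section Calculus

variable {E G G' H : Type*} [NormedAddCommGroup E] [NormedSpace ℝ E]
  [NormedAddCommGroup G] [NormedSpace ℝ G] [NormedAddCommGroup G'] [NormedSpace ℝ G']
  [NormedAddCommGroup H] [NormedSpace ℝ H]

theorem fderiv_clm_apply_apply {A : E → G →L[ℝ] H} {X : E → G} {x : E}
    (hA : DifferentiableAt ℝ A x) (hX : DifferentiableAt ℝ X x) (z : E) :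
    fderiv ℝ (fun y => A y (X y)) x z = fderiv ℝ A x z (X x) + A x (fderiv ℝ X x z) := by
  rw [fderiv_clm_apply hA hX]
  simp [add_comm]

theorem fderiv_clm_apply₂_apply {B : E → G →L[ℝ] G' →L[ℝ] H} {X : E → G} {Y : E → G'} {x : E}
    (hB : DifferentiableAt ℝ B x) (hX : DifferentiableAt ℝ X x) (hY : DifferentiableAt ℝ Y x)
    (z : E) :
    fderiv ℝ (fun y => B y (X y) (Y y)) x z = fderiv ℝ B x z (X x) (Y x)
      + B x (fderiv ℝ X x z) (Y x) + B x (X x) (fderiv ℝ Y x z) := by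
  rw [fderiv_clm_apply_apply (hB.clm_apply hX) hY, fderiv_clm_apply_apply hB hX]
  simp

theorem fderiv_clm_apply₂_const_apply {B : E → G →L[ℝ] G' →L[ℝ] H} {x : E}
    (hB : DifferentiableAt ℝ B x) (v : G) (w : G') (z : E) :
    fderiv ℝ (fun y => B y v w) x z = fderiv ℝ B x z v w := by
  rw [fderiv_clm_apply₂_apply hB (differentiableAt_const v) (differentiableAt_const w)]
  simp

theorem differentiableAt_of_contDiffAt {f : E → G} {x : E} (h : ContDiffAt ℝ ∞ f x) :
    DifferentiableAt ℝ f x :=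
  h.differentiableAt (by simp)

theorem contDiffAt_fderiv {f : E → G} {x : E} (h : ContDiffAt ℝ ∞ f x) :
    ContDiffAt ℝ ∞ (fderiv ℝ f) x :=
  h.fderiv_right (by simp)

theorem fderiv_fderiv_comm {f : E → G} {x : E} (h : ContDiffAt ℝ ∞ f x) (v w : E) :
    fderiv ℝ (fderiv ℝ f) x v w = fderiv ℝ (fderiv ℝ f) x w v :=
  (h.isSymmSndFDerivAt (by simpa using WithTop.coe_le_coe.2 (le_top (a := (2 : ℕ∞))))).eq v w

theorem fderiv_apply_congr {f g : E → G} {U : Set E} {x : E} (hU : IsOpen U) (hx : x ∈ U)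
    (h : Set.EqOn f g U) (z : E) : fderiv ℝ f x z = fderiv ℝ g x z := by
  rw [(h.eventuallyEq_of_mem (hU.mem_nhds hx)).fderiv_eq]

theorem isInvertible_of_bijective [FiniteDimensional ℝ E] {A : E →L[ℝ] G}
    (h : Function.Bijective A) : A.IsInvertible :=
  ⟨(LinearEquiv.ofBijective A.toLinearMap h).toContinuousLinearEquiv, by ext; rfl⟩

theorem bijective_coprod_iff {A : E →L[ℝ] H} {B : G →L[ℝ] H} :
    Function.Bijective (A.coprod B)
      ↔ Function.Injective A ∧ Function.Injective B ∧ IsCompl A.range B.range := by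
  constructor
  · rintro ⟨hinj, hsurj⟩
    refine ⟨fun v w h => ?_, fun v w h => ?_, Submodule.disjoint_def.2 ?_, ?_⟩
    · exact congrArg Prod.fst (hinj (a₁ := (v, 0)) (a₂ := (w, 0)) (by simpa using h))
    · exact congrArg Prod.snd (hinj (a₁ := (0, v)) (a₂ := (0, w)) (by simpa using h))
    · rintro _ ⟨v, rfl⟩ ⟨w, hw⟩
      have h : (v, -w) = (0 : E × G) :=
        hinj (by simpa [← sub_eq_add_neg, sub_eq_zero] using hw.symm)
      rw [show v = 0 from congrArg Prod.fst h, map_zero]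
    · rw [codisjoint_iff, ← ContinuousLinearMap.range_coprod]
      exact LinearMap.range_eq_top.2 hsurj
  · rintro ⟨hA, hB, hAB⟩
    constructor
    · refine LinearMap.ker_eq_bot.1 ((LinearMap.ker_coprod_of_disjoint_range A.toLinearMap
        B.toLinearMap hAB.disjoint).trans ?_)
      rw [LinearMap.ker_eq_bot.2 hA, LinearMap.ker_eq_bot.2 hB, Submodule.prod_bot]
    · exact LinearMap.range_eq_top.1
        ((LinearMap.range_coprod A.toLinearMap B.toLinearMap).trans hAB.sup_eq_top)

end Calculus

/-! ### The structure equations of a centroaffine hypersurface -/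

section Frame

variable {E F : Type*} [NormedAddCommGroup E] [NormedSpace ℝ E]
  [NormedAddCommGroup F] [NormedSpace ℝ F] {ε : ℝ} {f : E → F} {U : Set E} {x : E}

theorem frame_apply (f : E → F) (x v : E) (t : ℝ) :
    frame f x (v, t) = fderiv ℝ f x v + t • f x := by
  simp [frame]

theorem frame_bijective_iff : Function.Bijective (frame f x) ↔
    Function.Injective (fderiv ℝ f x) ∧ f x ≠ 0
      ∧ IsCompl (fderiv ℝ f x).range (Submodule.span ℝ {f x}) := by
  have hinj : Function.Injective (ContinuousLinearMap.toSpanSingleton ℝ (f x)) ↔ f x ≠ 0 :=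
    ⟨fun h h0 => one_ne_zero (h (a₁ := (1 : ℝ)) (a₂ := 0) (by simp [h0])),
      fun h => smul_left_injective ℝ h⟩
  have hrange : (ContinuousLinearMap.toSpanSingleton ℝ (f x)).range = Submodule.span ℝ {f x} :=
    (LinearMap.span_singleton_eq_range ℝ F (f x)).symm
  rw [frame, bijective_coprod_iff, hinj, hrange]

theorem contDiffAt_frame (h : ContDiffAt ℝ ∞ f x) : ContDiffAt ℝ ∞ (frame f) x := by
  have hframe : frame f = fun y => (fderiv ℝ f y).comp (ContinuousLinearMap.fst ℝ E ℝ)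
      + (ContinuousLinearMap.toSpanSingletonCLE (𝕜 := ℝ) (f y)).comp
        (ContinuousLinearMap.snd ℝ E ℝ) := by
    ext <;> simp [frame]
  rw [hframe]
  exact ((contDiffAt_fderiv h).clm_comp contDiffAt_const).add
    (((ContinuousLinearMap.toSpanSingletonCLE (𝕜 := ℝ) (E := F)).contDiff.contDiffAt.comp x
      h).clm_comp contDiffAt_const)

theorem metric_apply (ε : ℝ) (f : E → F) (x v w : E) :
    metric ε f x v w = -ε * ((frame f x).inverse (fderiv ℝ (fderiv ℝ f) x v w)).2 := by
  simp [metric]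

theorem inducedConn_apply (f : E → F) (x v w : E) :
    inducedConn f x v w = ((frame f x).inverse (fderiv ℝ (fderiv ℝ f) x v w)).1 := by
  simp [inducedConn]

theorem metric_eq_of_gauss [FiniteDimensional ℝ E] (hε : ε = 1 ∨ ε = -1)
    (hb : Function.Bijective (frame f x)) {v w z : E} {t : ℝ}
    (h : fderiv ℝ (fderiv ℝ f) x v w = fderiv ℝ f x z - (ε * t) • f x) :
    metric ε f x v w = t ∧ inducedConn f x v w = z := by
  have hframe : fderiv ℝ (fderiv ℝ f) x v w = frame f x (z, -(ε * t)) := by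
    rw [h, frame_apply, neg_smul, sub_eq_add_neg]
  rw [metric_apply, inducedConn_apply, hframe,
    (isInvertible_of_bijective hb).inverse_apply_self]
  refine ⟨?_, rfl⟩
  rcases hε with rfl | rfl <;> simp

namespace IsConvexCentroaffineOn

theorem mono {V : Set E} (hf : IsConvexCentroaffineOn ε f U) (h : V ⊆ U) :
    IsConvexCentroaffineOn ε f V :=
  ⟨hf.eps, hf.smooth.mono h, fun x hx => hf.immersion x (h hx), fun x hx => hf.ne_zero x (h hx),
    fun x hx => hf.transversal x (h hx), fun x hx => hf.posDef x (h hx)⟩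

theorem mul_self_eps (hf : IsConvexCentroaffineOn ε f U) : ε * ε = 1 := by
  rcases hf.eps with rfl | rfl <;> simp

theorem eps_ne_zero (hf : IsConvexCentroaffineOn ε f U) : ε ≠ 0 :=
  left_ne_zero_of_mul_eq_one hf.mul_self_eps

theorem frame_bijective (hf : IsConvexCentroaffineOn ε f U) (hx : x ∈ U) :
    Function.Bijective (frame f x) :=
  frame_bijective_iff.2 ⟨hf.immersion x hx, hf.ne_zero x hx, hf.transversal x hx⟩

theorem contDiffAt (hf : IsConvexCentroaffineOn ε f U) (hU : IsOpen U) (hx : x ∈ U) :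
    ContDiffAt ℝ ∞ f x :=
  hf.smooth.contDiffAt (hU.mem_nhds hx)

theorem metric_comm (hf : IsConvexCentroaffineOn ε f U) (hU : IsOpen U) (hx : x ∈ U) (v w : E) :
    metric ε f x v w = metric ε f x w v := by
  rw [metric_apply, metric_apply, fderiv_fderiv_comm (hf.contDiffAt hU hx)]

theorem inducedConn_comm (hf : IsConvexCentroaffineOn ε f U) (hU : IsOpen U) (hx : x ∈ U)
    (v w : E) : inducedConn f x v w = inducedConn f x w v := by
  rw [inducedConn_apply, inducedConn_apply, fderiv_fderiv_comm (hf.contDiffAt hU hx)]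

theorem eq_of_metric (hf : IsConvexCentroaffineOn ε f U) (hx : x ∈ U) {v w : E}
    (h : ∀ z, metric ε f x v z = metric ε f x w z) : v = w := by
  by_contra hvw
  exact (hf.posDef x hx _ (sub_ne_zero.2 hvw)).ne' (by simp [h])

variable [FiniteDimensional ℝ E]

theorem frame_isInvertible (hf : IsConvexCentroaffineOn ε f U) (hx : x ∈ U) :
    (frame f x).IsInvertible :=
  isInvertible_of_bijective (hf.frame_bijective hx)

theorem gauss (hf : IsConvexCentroaffineOn ε f U) (hx : x ∈ U) (v w : E) :
    fderiv ℝ (fderiv ℝ f) x v w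
      = fderiv ℝ f x (inducedConn f x v w) - (ε * metric ε f x v w) • f x := by
  conv_lhs => rw [← (hf.frame_isInvertible hx).self_apply_inverse (fderiv ℝ (fderiv ℝ f) x v w)]
  rw [metric_apply, inducedConn_apply, ← mul_assoc, mul_neg, hf.mul_self_eps, neg_one_mul,
    neg_smul, sub_neg_eq_add, ← frame_apply]

theorem metric_isInvertible (hf : IsConvexCentroaffineOn ε f U) (hx : x ∈ U) :
    (metric ε f x).IsInvertible := by
  have hinj : Function.Injective (metric ε f x).toLinearMap := fun v w h =>
    hf.eq_of_metric hx fun z => DFunLike.congr_fun h z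
  refine isInvertible_of_bijective ⟨hinj, ?_⟩
  refine (LinearMap.injective_iff_surjective_of_finrank_eq_finrank ?_).1 hinj
  rw [← (LinearMap.toContinuousLinearMap (𝕜 := ℝ) (E := E) (F' := ℝ)).finrank_eq]
  exact (Subspace.dual_finrank_eq (K := ℝ) (V := E)).symm

theorem contDiffAt_frame_inverse (hf : IsConvexCentroaffineOn ε f U) (hU : IsOpen U)
    (hx : x ∈ U) : ContDiffAt ℝ ∞ (fun y => (frame f y).inverse) x := by
  have : CompleteSpace (E × ℝ) := FiniteDimensional.complete ℝ _
  exact (hf.frame_isInvertible hx).contDiffAt_map_inverse.comp x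
    (contDiffAt_frame (hf.contDiffAt hU hx))

theorem contDiffAt_metric (hf : IsConvexCentroaffineOn ε f U) (hU : IsOpen U) (hx : x ∈ U) :
    ContDiffAt ℝ ∞ (metric ε f) x := by
  refine (contDiffAt_const (c := -ε)).smul (ContDiffAt.clm_comp ?_
    (contDiffAt_fderiv (contDiffAt_fderiv (hf.contDiffAt hU hx))))
  exact (ContinuousLinearMap.compL ℝ E F ℝ).contDiff.contDiffAt.comp x
    (contDiffAt_const.clm_comp (hf.contDiffAt_frame_inverse hU hx))

theorem contDiffAt_inducedConn (hf : IsConvexCentroaffineOn ε f U) (hU : IsOpen U) (hx : x ∈ U) :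
    ContDiffAt ℝ ∞ (inducedConn f) x := by
  refine ContDiffAt.clm_comp ?_ (contDiffAt_fderiv (contDiffAt_fderiv (hf.contDiffAt hU hx)))
  exact (ContinuousLinearMap.compL ℝ E F E).contDiff.contDiffAt.comp x
    (contDiffAt_const.clm_comp (hf.contDiffAt_frame_inverse hU hx))

theorem fderiv_metric_comm (hf : IsConvexCentroaffineOn ε f U) (hU : IsOpen U) (hx : x ∈ U)
    (z v w : E) : fderiv ℝ (metric ε f) x z v w = fderiv ℝ (metric ε f) x z w v := by
  have hd := differentiableAt_of_contDiffAt (hf.contDiffAt_metric hU hx)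
  rw [← fderiv_clm_apply₂_const_apply hd, ← fderiv_clm_apply₂_const_apply hd]
  exact fderiv_apply_congr hU hx (fun y hy => hf.metric_comm hU hy v w) z

theorem fderiv_fderiv_fderiv (hf : IsConvexCentroaffineOn ε f U) (hU : IsOpen U) (hx : x ∈ U)
    (z v w : E) : fderiv ℝ (fderiv ℝ (fderiv ℝ f)) x z v w
      = frame f x (fderiv ℝ (inducedConn f) x z v w + inducedConn f x z (inducedConn f x v w)
          - (ε * metric ε f x v w) • z,
        -(ε * (fderiv ℝ (metric ε f) x z v w + metric ε f x z (inducedConn f x v w)))) := by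
  have hf' := contDiffAt_fderiv (hf.contDiffAt hU hx)
  have df := differentiableAt_of_contDiffAt (hf.contDiffAt hU hx)
  have df' := differentiableAt_of_contDiffAt hf'
  have dconn := differentiableAt_of_contDiffAt (hf.contDiffAt_inducedConn hU hx)
  have dmetric := differentiableAt_of_contDiffAt (hf.contDiffAt_metric hU hx)
  have dconn' : DifferentiableAt ℝ (fun y => inducedConn f y v w) x := by fun_prop
  have dmetric' : DifferentiableAt ℝ (fun y => metric ε f y v w) x := by fun_prop
  rw [← fderiv_clm_apply₂_const_apply (differentiableAt_of_contDiffAt (contDiffAt_fderiv hf')),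
    fderiv_apply_congr hU hx fun y hy => hf.gauss hy v w,
    fderiv_fun_sub (df'.clm_apply dconn') ((dmetric'.const_mul ε).fun_smul df), sub_apply,
    fderiv_clm_apply_apply df' dconn', fderiv_clm_apply₂_const_apply dconn, hf.gauss hx,
    fderiv_fun_smul (dmetric'.const_mul ε) df, fderiv_const_mul dmetric', frame_apply]
  simp only [add_apply, smul_apply, ContinuousLinearMap.smulRight_apply,
    fderiv_clm_apply₂_const_apply dmetric, map_add, map_sub, map_smul]
  module

/-- The equation of Codazzi: `C = ∇h` is totally symmetric. -/
theorem codazzi (hf : IsConvexCentroaffineOn ε f U) (hU : IsOpen U) (hx : x ∈ U) (z v w : E) :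
    fderiv ℝ (metric ε f) x z v w + metric ε f x z (inducedConn f x v w)
      = fderiv ℝ (metric ε f) x v z w + metric ε f x v (inducedConn f x z w) := by
  have h := DFunLike.congr_fun
    (fderiv_fderiv_comm (contDiffAt_fderiv (hf.contDiffAt hU hx)) z v) w
  rw [hf.fderiv_fderiv_fderiv hU hx, hf.fderiv_fderiv_fderiv hU hx] at h
  exact mul_left_cancel₀ hf.eps_ne_zero
    (neg_inj.1 (congrArg Prod.snd ((hf.frame_bijective hx).injective h)))

end IsConvexCentroaffineOn

end Frame

section Tensors

variable {E F : Type*} [NormedAddCommGroup E] [NormedSpace ℝ E]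
  [NormedAddCommGroup F] [NormedSpace ℝ F]

/-- The Christoffel symbol `leviCivita` as a continuous bilinear map, in order to differentiate
it. -/
noncomputable def leviCivitaL (ε : ℝ) (f : E → F) (x : E) : E →L[ℝ] E →L[ℝ] E :=
  let Dh := fderiv ℝ (metric ε f) x
  (1 / 2 : ℝ) • (ContinuousLinearMap.compL ℝ E (E →L[ℝ] ℝ) E (metric ε f x).inverse).comp
    (Dh + Dh.flip
      - ((ContinuousLinearMap.flipₗᵢ ℝ E E ℝ : (E →L[ℝ] E →L[ℝ] ℝ) →L[ℝ] E →L[ℝ] E →L[ℝ] ℝ)).comp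
        Dh.flip)

/-- The difference tensor `diffTensor` as a continuous bilinear map, in order to differentiate
it. -/
noncomputable def diffTensorL (ε : ℝ) (f : E → F) (x : E) : E →L[ℝ] E →L[ℝ] E :=
  inducedConn f x - leviCivitaL ε f x

/-- `∇̂K = 0` on `U`. -/
def HasParallelDiffTensorOn (ε : ℝ) (f : E → F) (U : Set E) : Prop :=
  ∀ x ∈ U, ∀ z v w : E, covDerivDiffTensor ε f x z v w = 0

theorem HasParallelDiffTensorOn.mono {ε : ℝ} {f : E → F} {U V : Set E}
    (hK : HasParallelDiffTensorOn ε f U) (h : V ⊆ U) : HasParallelDiffTensorOn ε f V :=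
  fun x hx => hK x (h hx)

theorem leviCivitaL_apply (ε : ℝ) (f : E → F) (x v w : E) :
    leviCivitaL ε f x v w = leviCivita ε f x v w := by
  simp [leviCivitaL, leviCivita]

theorem diffTensorL_apply (ε : ℝ) (f : E → F) (x v w : E) :
    diffTensorL ε f x v w = diffTensor ε f x v w := by
  simp [diffTensorL, diffTensor, leviCivitaL_apply]

theorem inducedConn_eq_add (ε : ℝ) (f : E → F) (x v w : E) :
    inducedConn f x v w = leviCivitaL ε f x v w + diffTensorL ε f x v w := by
  simp [diffTensorL]

namespace IsConvexCentroaffineOn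

variable [FiniteDimensional ℝ E] {ε : ℝ} {f : E → F} {U : Set E} {x : E}

theorem contDiffAt_leviCivitaL (hf : IsConvexCentroaffineOn ε f U) (hU : IsOpen U) (hx : x ∈ U) :
    ContDiffAt ℝ ∞ (leviCivitaL ε f) x := by
  have : CompleteSpace E := FiniteDimensional.complete ℝ _
  have hD := contDiffAt_fderiv (hf.contDiffAt_metric hU hx)
  have hflip : ContDiffAt ℝ ∞ (fun y => (fderiv ℝ (metric ε f) y).flip) x :=
    (ContinuousLinearMap.flipₗᵢ ℝ E E (E →L[ℝ] ℝ)).contDiff.contDiffAt.comp x hD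
  refine (contDiffAt_const (c := (1 / 2 : ℝ))).smul (ContDiffAt.clm_comp ?_ ((hD.add hflip).sub
    (contDiffAt_const.clm_comp hflip)))
  exact (ContinuousLinearMap.compL ℝ E (E →L[ℝ] ℝ) E).contDiff.contDiffAt.comp x
    ((hf.metric_isInvertible hx).contDiffAt_map_inverse.comp x (hf.contDiffAt_metric hU hx))

theorem contDiffAt_diffTensorL (hf : IsConvexCentroaffineOn ε f U) (hU : IsOpen U) (hx : x ∈ U) :
    ContDiffAt ℝ ∞ (diffTensorL ε f) x :=
  (hf.contDiffAt_inducedConn hU hx).sub (hf.contDiffAt_leviCivitaL hU hx)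

theorem koszul (hf : IsConvexCentroaffineOn ε f U) (hx : x ∈ U) (v w z : E) :
    metric ε f x (leviCivitaL ε f x v w) z = (1 / 2 : ℝ) * (fderiv ℝ (metric ε f) x v w z
      + fderiv ℝ (metric ε f) x w v z - fderiv ℝ (metric ε f) x z v w) := by
  rw [leviCivitaL_apply, leviCivita, map_smul, (hf.metric_isInvertible hx).self_apply_inverse]
  simp

theorem leviCivitaL_comm (hf : IsConvexCentroaffineOn ε f U) (hU : IsOpen U) (hx : x ∈ U)
    (v w : E) : leviCivitaL ε f x v w = leviCivitaL ε f x w v :=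
  hf.eq_of_metric hx fun z => by
    rw [hf.koszul hx, hf.koszul hx, hf.fderiv_metric_comm hU hx z v w]; ring

theorem diffTensorL_comm (hf : IsConvexCentroaffineOn ε f U) (hU : IsOpen U) (hx : x ∈ U)
    (v w : E) : diffTensorL ε f x v w = diffTensorL ε f x w v := by
  simp only [diffTensorL, sub_apply, hf.leviCivitaL_comm hU hx v w,
    hf.inducedConn_comm hU hx v w]

theorem fderiv_metric (hf : IsConvexCentroaffineOn ε f U) (hU : IsOpen U) (hx : x ∈ U)
    (z v w : E) : fderiv ℝ (metric ε f) x z v w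
      = metric ε f x (leviCivitaL ε f x z v) w + metric ε f x v (leviCivitaL ε f x z w) := by
  rw [hf.metric_comm hU hx v, hf.koszul hx, hf.koszul hx, hf.fderiv_metric_comm hU hx w z v,
    hf.fderiv_metric_comm hU hx v z w, hf.fderiv_metric_comm hU hx z w v]
  ring

theorem metric_diffTensorL_comm (hf : IsConvexCentroaffineOn ε f U) (hU : IsOpen U) (hx : x ∈ U)
    (u v w : E) :
    metric ε f x (diffTensorL ε f x u v) w = metric ε f x (diffTensorL ε f x u w) v := by
  have h := hf.codazzi hU hx v w u
  rw [hf.fderiv_metric hU hx, hf.fderiv_metric hU hx, inducedConn_eq_add ε,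
    inducedConn_eq_add ε, hf.leviCivitaL_comm hU hx w v, hf.metric_comm hU hx w,
    hf.metric_comm hU hx v, hf.metric_comm hU hx w, hf.metric_comm hU hx v] at h
  simp only [map_add, add_apply] at h
  rw [hf.diffTensorL_comm hU hx u v, hf.diffTensorL_comm hU hx u w]
  linarith

theorem cubicForm_eq (hf : IsConvexCentroaffineOn ε f U) (hU : IsOpen U) (hx : x ∈ U)
    (u v w : E) : cubicForm ε f x u v w = -2 * metric ε f x (diffTensorL ε f x u v) w := by
  rw [cubicForm, fderiv_clm_apply₂_const_apply
      (differentiableAt_of_contDiffAt (hf.contDiffAt_metric hU hx)), hf.fderiv_metric hU hx,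
    inducedConn_eq_add ε, inducedConn_eq_add ε, hf.metric_comm hU hx v, hf.metric_comm hU hx v]
  simp only [map_add, add_apply]
  rw [hf.metric_diffTensorL_comm hU hx u w v]
  ring

theorem fderiv_diffTensorL (hf : IsConvexCentroaffineOn ε f U) (hU : IsOpen U)
    (hK : HasParallelDiffTensorOn ε f U) (hx : x ∈ U) (z v w : E) :
    fderiv ℝ (diffTensorL ε f) x z v w = diffTensorL ε f x (leviCivitaL ε f x z v) w
      + diffTensorL ε f x v (leviCivitaL ε f x z w)
      - leviCivitaL ε f x z (diffTensorL ε f x v w) := by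
  have h := hK x hx z v w
  simp only [covDerivDiffTensor, ← diffTensorL_apply, ← leviCivitaL_apply] at h
  rw [fderiv_clm_apply₂_const_apply
    (differentiableAt_of_contDiffAt (hf.contDiffAt_diffTensorL hU hx))] at h
  linear_combination (norm := module) h

end IsConvexCentroaffineOn

end Tensors

/-! ### Principal unit fields of the difference tensor -/

section PrincipalField

variable {E F : Type*} [NormedAddCommGroup E] [NormedSpace ℝ E]
  [NormedAddCommGroup F] [NormedSpace ℝ F]

/-- On the open set `U`, `f` is a locally strongly convex centroaffine hypersurface and `T` is a
smooth unit field with `K(T, T) = a T` and `K(T, v) = b v` for all `v` orthogonal to `T`, where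
`a ≠ 2 b`. -/
structure IsPrincipalField (ε : ℝ) (f : E → F) (U : Set E) (T : E → E) (a b : E → ℝ) : Prop
    extends IsConvexCentroaffineOn ε f U where
  isOpen : IsOpen U
  contDiffOn_field : ContDiffOn ℝ ∞ T U
  metric_self : ∀ x ∈ U, metric ε f x (T x) (T x) = 1
  diffTensorL_self : ∀ x ∈ U, diffTensorL ε f x (T x) (T x) = a x • T x
  diffTensorL_orth :
    ∀ x ∈ U, ∀ v, metric ε f x (T x) v = 0 → diffTensorL ε f x (T x) v = b x • v
  ne_two_mul : ∀ x ∈ U, a x ≠ 2 * b x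

/-- The vector `c f_*T - ε f`. If `∇̂K = 0` and `c = a - b` for the constant eigenvalues `a, b` of a
principal field `T`, it spans the one-dimensional factor of the Calabi product. -/
noncomputable def axis (ε c : ℝ) (f : E → F) (T : E → E) (x : E) : F :=
  c • fderiv ℝ f x (T x) - ε • f x

theorem exists_ne_zero_apply_eq_zero (hdim : 2 ≤ Module.finrank ℝ E) (η : E →L[ℝ] ℝ) :
    ∃ v, v ≠ 0 ∧ η v = 0 := by
  have : FiniteDimensional ℝ E := Module.finite_of_finrank_pos (by omega)
  obtain ⟨v, hv, hv0⟩ := Submodule.exists_mem_ne_zero_of_ne_bot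
    (LinearMap.ker_ne_bot_of_finrank_lt (f := η.toLinearMap) (by rw [Module.finrank_self]; omega))
  exact ⟨v, hv0, hv⟩

namespace IsPrincipalField

variable {ε : ℝ} {f : E → F} {U : Set E} {T : E → E} {a b : E → ℝ} {x : E}

theorem mono {V : Set E} (hT : IsPrincipalField ε f U T a b) (hV : IsOpen V) (h : V ⊆ U) :
    IsPrincipalField ε f V T a b where
  toIsConvexCentroaffineOn := hT.toIsConvexCentroaffineOn.mono h
  isOpen := hV
  contDiffOn_field := hT.contDiffOn_field.mono h
  metric_self x hx := hT.metric_self x (h hx)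
  diffTensorL_self x hx := hT.diffTensorL_self x (h hx)
  diffTensorL_orth x hx := hT.diffTensorL_orth x (h hx)
  ne_two_mul x hx := hT.ne_two_mul x (h hx)

theorem contDiffAt_field (hT : IsPrincipalField ε f U T a b) (hx : x ∈ U) : ContDiffAt ℝ ∞ T x :=
  hT.contDiffOn_field.contDiffAt (hT.isOpen.mem_nhds hx)

theorem contDiffAt_tangent (hT : IsPrincipalField ε f U T a b) (hx : x ∈ U) :
    ContDiffAt ℝ ∞ (fun y => fderiv ℝ f y (T y)) x :=
  (contDiffAt_fderiv (hT.contDiffAt hT.isOpen hx)).clm_apply (hT.contDiffAt_field hx)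

theorem differentiableAt_field (hT : IsPrincipalField ε f U T a b) (hx : x ∈ U) :
    DifferentiableAt ℝ T x :=
  differentiableAt_of_contDiffAt (hT.contDiffAt_field hx)

theorem contDiffAt_axis (hT : IsPrincipalField ε f U T a b) (hx : x ∈ U)
    (c : ℝ) : ContDiffAt ℝ ∞ (axis ε c f T) x :=
  ((hT.contDiffAt_tangent hx).const_smul c).sub ((hT.contDiffAt hT.isOpen hx).const_smul ε)

theorem diffTensorL_apply (hT : IsPrincipalField ε f U T a b) (hx : x ∈ U) (v : E) :
    diffTensorL ε f x (T x) v = b x • v + ((a x - b x) * metric ε f x (T x) v) • T x := by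
  have h := hT.diffTensorL_orth x hx (v - metric ε f x (T x) v • T x)
    (by simp [hT.metric_self x hx])
  rw [map_sub, map_smul, hT.diffTensorL_self x hx] at h
  linear_combination (norm := module) h

variable [FiniteDimensional ℝ E]

theorem differentiableAt_metric (hT : IsPrincipalField ε f U T a b) (hx : x ∈ U) :
    DifferentiableAt ℝ (metric ε f) x :=
  differentiableAt_of_contDiffAt (hT.contDiffAt_metric hT.isOpen hx)

theorem differentiableAt_diffTensorL (hT : IsPrincipalField ε f U T a b) (hx : x ∈ U) :
    DifferentiableAt ℝ (diffTensorL ε f) x :=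
  differentiableAt_of_contDiffAt (hT.contDiffAt_diffTensorL hT.isOpen hx)

theorem contDiffAt_dual (hT : IsPrincipalField ε f U T a b) (hx : x ∈ U) :
    ContDiffAt ℝ ∞ (fun y => metric ε f y (T y)) x :=
  (hT.contDiffAt_metric hT.isOpen hx).clm_apply (hT.contDiffAt_field hx)

theorem metric_covDeriv_field (hT : IsPrincipalField ε f U T a b) (hx : x ∈ U) (z : E) :
    metric ε f x (T x) (fderiv ℝ T x z + leviCivitaL ε f x z (T x)) = 0 := by
  have dT := hT.differentiableAt_field hx
  have h := fderiv_apply_congr hT.isOpen hx hT.metric_self z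
  rw [fderiv_clm_apply₂_apply (hT.differentiableAt_metric hx) dT dT,
    hT.fderiv_metric hT.isOpen hx, hT.metric_comm hT.isOpen hx _ (T x),
    hT.metric_comm hT.isOpen hx _ (T x), fderiv_const_apply, zero_apply] at h
  rw [map_add]
  linarith

theorem differentiableAt_eigenvalue (hT : IsPrincipalField ε f U T a b) (hx : x ∈ U) :
    DifferentiableAt ℝ a x := by
  have dmetric := hT.differentiableAt_metric hx
  have dT := hT.differentiableAt_field hx
  have dK := hT.differentiableAt_diffTensorL hx
  have ha : a =ᶠ[nhds x] fun y => metric ε f y (diffTensorL ε f y (T y) (T y)) (T y) := by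
    filter_upwards [hT.isOpen.mem_nhds hx] with y hy
    rw [hT.diffTensorL_self y hy, map_smul, smul_apply, hT.metric_self y hy, smul_eq_mul, mul_one]
  rw [ha.differentiableAt_iff]
  fun_prop

/-- Differentiate `K(T, T) = a T` and use that `∇̂_z T` is orthogonal to `T`. -/
theorem smul_covDeriv_field (hT : IsPrincipalField ε f U T a b)
    (hK : HasParallelDiffTensorOn ε f U) (hx : x ∈ U) (z : E) :
    (2 * b x - a x) • (fderiv ℝ T x z + leviCivitaL ε f x z (T x)) = fderiv ℝ a x z • T x := by
  have dT := hT.differentiableAt_field hx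
  have h := fderiv_apply_congr hT.isOpen hx hT.diffTensorL_self z
  rw [fderiv_clm_apply₂_apply (hT.differentiableAt_diffTensorL hx) dT dT,
    hT.fderiv_diffTensorL hT.isOpen hK hx,
    fderiv_fun_smul (hT.differentiableAt_eigenvalue hx) dT, hT.diffTensorL_self x hx,
    hT.diffTensorL_comm hT.isOpen hx _ (T x), hT.diffTensorL_comm hT.isOpen hx _ (T x)] at h
  have horth := hT.diffTensorL_orth x hx _ (hT.metric_covDeriv_field hx z)
  simp only [add_apply, smul_apply, ContinuousLinearMap.smulRight_apply, map_smul] at h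
  rw [map_add] at horth
  linear_combination (norm := module) h - (2 : ℝ) • horth

theorem fderiv_eigenvalue (hT : IsPrincipalField ε f U T a b)
    (hK : HasParallelDiffTensorOn ε f U) (hx : x ∈ U) : fderiv ℝ a x = 0 := by
  ext z
  have h := congrArg (metric ε f x (T x)) (hT.smul_covDeriv_field hK hx z)
  rw [map_smul, hT.metric_covDeriv_field hx, map_smul, hT.metric_self x hx] at h
  simpa using h.symm

/-- The field `T` is parallel. -/
theorem fderiv_field (hT : IsPrincipalField ε f U T a b) (hK : HasParallelDiffTensorOn ε f U)
    (hx : x ∈ U) (z : E) : fderiv ℝ T x z = -leviCivitaL ε f x z (T x) := by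
  have h := hT.smul_covDeriv_field hK hx z
  rw [hT.fderiv_eigenvalue hK hx, zero_apply, zero_smul] at h
  exact eq_neg_of_add_eq_zero_left
    ((smul_eq_zero.1 h).resolve_left (sub_ne_zero.2 (hT.ne_two_mul x hx).symm))

theorem fderiv_dual (hT : IsPrincipalField ε f U T a b) (hK : HasParallelDiffTensorOn ε f U)
    (hx : x ∈ U) (z v : E) : fderiv ℝ (fun y => metric ε f y (T y)) x z v
      = metric ε f x (T x) (leviCivitaL ε f x z v) := by
  rw [fderiv_clm_apply_apply (hT.differentiableAt_metric hx) (hT.differentiableAt_field hx),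
    hT.fderiv_field hK hx, add_apply, hT.fderiv_metric hT.isOpen hx]
  simp

theorem fderiv_dual_apply (hT : IsPrincipalField ε f U T a b)
    (hK : HasParallelDiffTensorOn ε f U) (hx : x ∈ U) (z v : E) :
    fderiv ℝ (fun y => metric ε f y (T y) v) x z
      = metric ε f x (T x) (leviCivitaL ε f x z v) := by
  rw [fderiv_clm_apply_apply (differentiableAt_of_contDiffAt (hT.contDiffAt_dual hx))
    (differentiableAt_const v), hT.fderiv_dual hK hx]
  simp

theorem differentiableAt_eigenvalue_orth (hT : IsPrincipalField ε f U T a b)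
    (hdim : 2 ≤ Module.finrank ℝ E) (hx : x ∈ U) : DifferentiableAt ℝ b x := by
  obtain ⟨w, hw, hw0⟩ := exists_ne_zero_apply_eq_zero hdim (metric ε f x (T x))
  have dmetric := hT.differentiableAt_metric hx
  have dT := hT.differentiableAt_field hx
  have dK := hT.differentiableAt_diffTensorL hx
  set q : E → E := fun y => w - metric ε f y (T y) w • T y with hq
  have dq : DifferentiableAt ℝ q x := by fun_prop
  have dnum : DifferentiableAt ℝ
      (fun y => metric ε f y (diffTensorL ε f y (T y) (q y)) (q y)) x := by fun_prop
  have dden : DifferentiableAt ℝ (fun y => metric ε f y (q y) (q y)) x := by fun_prop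
  have hne : metric ε f x (q x) (q x) ≠ 0 := by
    simpa [hq, hw0] using (hT.posDef x hx w hw).ne'
  have hb : b =ᶠ[nhds x] fun y => metric ε f y (diffTensorL ε f y (T y) (q y)) (q y)
      * (metric ε f y (q y) (q y))⁻¹ := by
    filter_upwards [hT.isOpen.mem_nhds hx, dden.continuousAt.eventually_ne hne] with y hy hy0
    rw [hT.diffTensorL_orth y hy (q y) (by simp [hq, hT.metric_self y hy]), map_smul, smul_apply,
      smul_eq_mul, mul_inv_cancel_right₀ hy0]
  rw [hb.differentiableAt_iff]
  exact dnum.mul (dden.inv hne)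

theorem fderiv_eigenvalue_orth (hT : IsPrincipalField ε f U T a b)
    (hK : HasParallelDiffTensorOn ε f U) (hdim : 2 ≤ Module.finrank ℝ E) (hx : x ∈ U) :
    fderiv ℝ b x = 0 := by
  obtain ⟨v, hv, hv0⟩ := exists_ne_zero_apply_eq_zero hdim (metric ε f x (T x))
  have dT := hT.differentiableAt_field hx
  have db := hT.differentiableAt_eigenvalue_orth hdim hx
  have dab : DifferentiableAt ℝ (fun y => a y - b y) x :=
    (hT.differentiableAt_eigenvalue hx).sub db
  have dη : DifferentiableAt ℝ (fun y => metric ε f y (T y) v) x :=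
    (differentiableAt_of_contDiffAt (hT.contDiffAt_dual hx)).clm_apply (differentiableAt_const v)
  ext z
  have h := fderiv_apply_congr hT.isOpen hx (fun y hy => hT.diffTensorL_apply hy v) z
  simp only [fderiv_clm_apply₂_apply (hT.differentiableAt_diffTensorL hx) dT
      (differentiableAt_const v), hT.fderiv_diffTensorL hT.isOpen hK hx,
    fderiv_fun_add (db.smul_const v) ((dab.fun_mul dη).fun_smul dT),
    fderiv_fun_smul (dab.fun_mul dη) dT, fderiv_smul_const db, fderiv_fun_mul dab dη,
    hT.fderiv_field hK hx, add_apply, smul_apply, ContinuousLinearMap.smulRight_apply,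
    hT.diffTensorL_apply hx, hv0, hT.fderiv_dual_apply hK hx, fderiv_const_apply, zero_apply,
    map_zero, map_neg, neg_apply, smul_eq_mul, map_add, map_smul] at h
  have hsmul : fderiv ℝ b x z • v = 0 := by
    linear_combination (norm := module) -h
  exact (smul_eq_zero.1 hsmul).resolve_right hv

theorem exists_const (hT : IsPrincipalField ε f U T a b) (hK : HasParallelDiffTensorOn ε f U)
    (hU : IsPreconnected U) (hdim : 2 ≤ Module.finrank ℝ E) :
    ∃ a₀ b₀ : ℝ, IsPrincipalField ε f U T (fun _ => a₀) (fun _ => b₀) := by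
  obtain ⟨a₀, ha⟩ := hT.isOpen.exists_is_const_of_fderiv_eq_zero hU
    (fun x hx => (hT.differentiableAt_eigenvalue hx).differentiableWithinAt)
    (fun x hx => hT.fderiv_eigenvalue hK hx)
  obtain ⟨b₀, hb⟩ := hT.isOpen.exists_is_const_of_fderiv_eq_zero hU
    (fun x hx => (hT.differentiableAt_eigenvalue_orth hdim hx).differentiableWithinAt)
    (fun x hx => hT.fderiv_eigenvalue_orth hK hdim hx)
  exact ⟨a₀, b₀,
    { toIsConvexCentroaffineOn := hT.toIsConvexCentroaffineOn
      isOpen := hT.isOpen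
      contDiffOn_field := hT.contDiffOn_field
      metric_self := hT.metric_self
      diffTensorL_self x hx := ha x hx ▸ hT.diffTensorL_self x hx
      diffTensorL_orth x hx := hb x hx ▸ hT.diffTensorL_orth x hx
      ne_two_mul x hx := ha x hx ▸ hb x hx ▸ hT.ne_two_mul x hx }⟩

section Const

variable {a b : ℝ}

theorem fderiv_tangent (hT : IsPrincipalField ε f U T (fun _ => a) (fun _ => b))
    (hK : HasParallelDiffTensorOn ε f U) (hx : x ∈ U) (z : E) :
    fderiv ℝ (fun y => fderiv ℝ f y (T y)) x z
      = b • fderiv ℝ f x z + metric ε f x (T x) z • axis ε (a - b) f T x := by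
  rw [fderiv_clm_apply_apply
    (differentiableAt_of_contDiffAt (contDiffAt_fderiv (hT.contDiffAt hT.isOpen hx)))
    (hT.differentiableAt_field hx), hT.fderiv_field hK hx, hT.gauss hx, inducedConn_eq_add ε,
    hT.diffTensorL_comm hT.isOpen hx, hT.diffTensorL_apply hx, hT.metric_comm hT.isOpen hx z, axis]
  simp only [map_add, map_neg, map_smul]
  module

theorem fderiv_axis (hT : IsPrincipalField ε f U T (fun _ => a) (fun _ => b))
    (hK : HasParallelDiffTensorOn ε f U) (hx : x ∈ U) (z : E) :
    fderiv ℝ (axis ε (a - b) f T) x z = ((a - b) * b - ε) • fderiv ℝ f x z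
      + ((a - b) * metric ε f x (T x) z) • axis ε (a - b) f T x := by
  have df := differentiableAt_of_contDiffAt (hT.contDiffAt hT.isOpen hx)
  have dX := differentiableAt_of_contDiffAt (hT.contDiffAt_tangent hx)
  unfold axis
  rw [fderiv_fun_sub (dX.fun_const_smul (a - b)) (df.fun_const_smul ε),
    fderiv_fun_const_smul dX, fderiv_fun_const_smul df, sub_apply, smul_apply, smul_apply,
    hT.fderiv_tangent hK hx, axis]
  module

theorem fderiv_fderiv_tangent (hT : IsPrincipalField ε f U T (fun _ => a) (fun _ => b))
    (hK : HasParallelDiffTensorOn ε f U) (hx : x ∈ U) (w z : E) :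
    fderiv ℝ (fderiv ℝ (fun y => fderiv ℝ f y (T y))) x w z
      = b • fderiv ℝ (fderiv ℝ f) x w z
        + metric ε f x (T x) (leviCivitaL ε f x w z) • axis ε (a - b) f T x
        + metric ε f x (T x) z • fderiv ℝ (axis ε (a - b) f T) x w := by
  have df' := differentiableAt_of_contDiffAt (contDiffAt_fderiv (hT.contDiffAt hT.isOpen hx))
  have dX' := differentiableAt_of_contDiffAt (contDiffAt_fderiv (hT.contDiffAt_tangent hx))
  have dW := differentiableAt_of_contDiffAt (hT.contDiffAt_axis hx (a - b))
  have dfz : DifferentiableAt ℝ (fun y => fderiv ℝ f y z) x := by fun_prop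
  have dηz : DifferentiableAt ℝ (fun y => metric ε f y (T y) z) x :=
    (differentiableAt_of_contDiffAt (hT.contDiffAt_dual hx)).clm_apply (differentiableAt_const z)
  have h := fderiv_apply_congr hT.isOpen hx (fun y hy => hT.fderiv_tangent hK hy z) w
  simp only [fderiv_clm_apply_apply dX' (differentiableAt_const z),
    fderiv_fun_add (dfz.fun_const_smul b) (dηz.fun_smul dW), fderiv_fun_const_smul dfz,
    fderiv_fun_smul dηz dW, add_apply, smul_apply, ContinuousLinearMap.smulRight_apply,
    fderiv_clm_apply_apply df' (differentiableAt_const z), hT.fderiv_dual_apply hK hx,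
    fderiv_const_apply, zero_apply, map_zero, add_zero] at h
  linear_combination (norm := module) h

/-- This is the integrability condition for the equation satisfied by `f_*T`. -/
theorem eps_eq (hT : IsPrincipalField ε f U T (fun _ => a) (fun _ => b))
    (hK : HasParallelDiffTensorOn ε f U) (hdim : 2 ≤ Module.finrank ℝ E) (hx : x ∈ U) :
    ε = b * (a - b) := by
  obtain ⟨v, hv, hv0⟩ := exists_ne_zero_apply_eq_zero hdim (metric ε f x (T x))
  have hsymm := fderiv_fderiv_comm (hT.contDiffAt_tangent hx) v (T x)
  rw [hT.fderiv_fderiv_tangent hK hx, hT.fderiv_fderiv_tangent hK hx, hv0, hT.metric_self x hx,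
    fderiv_fderiv_comm (hT.contDiffAt hT.isOpen hx) v, hT.leviCivitaL_comm hT.isOpen hx v,
    hT.fderiv_axis hK hx, hT.fderiv_axis hK hx, hv0] at hsymm
  have hsmul : ((a - b) * b - ε) • fderiv ℝ f x v = 0 := by
    linear_combination (norm := module) hsymm
  have hfv : fderiv ℝ f x v ≠ 0 := fun h => hv (hT.immersion x hx (by simpa using h))
  linarith [(smul_eq_zero.1 hsmul).resolve_right hfv]

end Const

end IsPrincipalField

end PrincipalField

/-! ### Splitting off the point factor -/

section LinearAlgebra

variable {E E₁ F : Type*} [NormedAddCommGroup E] [NormedSpace ℝ E]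
  [NormedAddCommGroup E₁] [NormedSpace ℝ E₁] [NormedAddCommGroup F] [NormedSpace ℝ F]

theorem exists_equiv_prod [FiniteDimensional ℝ E₁]
    (hdim : Module.finrank ℝ E = Module.finrank ℝ E₁ + 1) (η : E →L[ℝ] ℝ) {t : E} (ht : η t = 1) :
    ∃ L : E ≃L[ℝ] E₁ × ℝ, (∀ v, (L v).2 = η v) ∧ (L t).1 = 0 := by
  have : FiniteDimensional ℝ E := Module.finite_of_finrank_pos (by omega)
  let e := ContinuousLinearEquiv.equivOfRightInverse η (ContinuousLinearMap.toSpanSingleton ℝ t)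
    fun s => by simp [ht]
  have hker : Module.finrank ℝ η.ker = Module.finrank ℝ E₁ := by
    have h := e.toLinearEquiv.finrank_eq
    rw [Module.finrank_prod, Module.finrank_self] at h
    omega
  let j : η.ker ≃L[ℝ] E₁ := ContinuousLinearEquiv.ofFinrankEq hker
  refine ⟨e.trans ((ContinuousLinearEquiv.prodComm ℝ ℝ η.ker).trans
    (j.prodCongr (ContinuousLinearEquiv.refl ℝ ℝ))), fun v => rfl, ?_⟩
  have het : (e t).2 = 0 := by
    ext
    simp [e, ht]
  exact (congrArg j het).trans (map_zero j)

theorem smul_apply_eq_of_fderiv_eq_smul {U : Set E} (hU : IsOpen U) (hUc : IsPreconnected U)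
    {P : E → F} (hP : DifferentiableOn ℝ P U) {θ : E → E → ℝ}
    (hdP : ∀ x ∈ U, ∀ z, fderiv ℝ P x z = θ x z • P x) {φ : F →L[ℝ] ℝ}
    (hφ : ∀ x ∈ U, φ (P x) ≠ 0) {x y : E} (hx : x ∈ U) (hy : y ∈ U) :
    φ (P y) • P x = φ (P x) • P y := by
  have hderiv : ∀ x ∈ U, HasFDerivAt (fun y => (φ (P y))⁻¹ • P y) (0 : E →L[ℝ] F) x := by
    intro x hx
    have hPx := (hP.differentiableAt (hU.mem_nhds hx)).hasFDerivAt
    have hinv := (hasDerivAt_inv (hφ x hx)).comp_hasFDerivAt x (φ.hasFDerivAt.comp x hPx)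
    refine (hinv.fun_smul hPx).congr_fderiv ?_
    ext z
    simp only [Function.comp_apply, add_apply, smul_apply, ContinuousLinearMap.smulRight_apply,
      ContinuousLinearMap.comp_apply, hdP x hx, map_smul, smul_eq_mul, zero_apply]
    have := hφ x hx
    match_scalars
    field_simp
    ring
  have hconst := hU.is_const_of_fderiv_eq_zero hUc
    (fun x hx => (hderiv x hx).differentiableAt.differentiableWithinAt)
    (fun x hx => (hderiv x hx).fderiv) hx hy
  calc φ (P y) • P x = φ (P y) • φ (P x) • (φ (P x))⁻¹ • P x := by rw [smul_inv_smul₀ (hφ x hx)]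
    _ = φ (P x) • φ (P y) • (φ (P y))⁻¹ • P y := by rw [hconst, smul_comm]
    _ = φ (P x) • P y := by rw [smul_inv_smul₀ (hφ y hy)]

end LinearAlgebra

section Rigidity

variable {E F F' : Type*} [NormedAddCommGroup E] [NormedSpace ℝ E]
  [NormedAddCommGroup F] [NormedSpace ℝ F] [NormedAddCommGroup F'] [NormedSpace ℝ F']
  {ε : ℝ} {f : E → F} {g : E → F'} {U : Set E} {x : E}

theorem fderiv_frame (hf : ContDiffAt ℝ ∞ f x) (z v : E) (t : ℝ) :
    fderiv ℝ (frame f) x z (v, t) = fderiv ℝ (fderiv ℝ f) x z v + t • fderiv ℝ f x z := by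
  have df := differentiableAt_of_contDiffAt hf
  have df' := differentiableAt_of_contDiffAt (contDiffAt_fderiv hf)
  have dfv : DifferentiableAt ℝ (fun y => fderiv ℝ f y v) x := by fun_prop
  have h := fderiv_clm_apply_apply (differentiableAt_of_contDiffAt (contDiffAt_frame hf))
    (differentiableAt_const (v, t)) z
  simp only [frame_apply, fderiv_fun_add dfv (df.fun_const_smul t), fderiv_fun_const_smul df,
    fderiv_const_apply, zero_apply, map_zero, add_zero, add_apply, smul_apply,
    fderiv_clm_apply_apply df' (differentiableAt_const v)] at h
  exact h.symm

namespace IsConvexCentroaffineOn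

variable [FiniteDimensional ℝ E]

theorem fderiv_frame_comp_inverse (hf : IsConvexCentroaffineOn ε f U) (hU : IsOpen U)
    (hg : ContDiffOn ℝ ∞ g U)
    (hgauss : ∀ x ∈ U, ∀ v w, fderiv ℝ (fderiv ℝ g) x v w
      = fderiv ℝ g x (inducedConn f x v w) - (ε * metric ε f x v w) • g x) (hx : x ∈ U) :
    DifferentiableAt ℝ (fun y => (frame g y).comp (frame f y).inverse) x ∧
      fderiv ℝ (fun y => (frame g y).comp (frame f y).inverse) x = 0 := by
  set B : E → F →L[ℝ] F' := fun y => (frame g y).comp (frame f y).inverse with hB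
  have hBf : ∀ y ∈ U, ∀ e, B y (frame f y e) = frame g y e := fun y hy e => by
    simp [hB, (hf.frame_isInvertible hy).inverse_apply_self]
  have hfx := hf.contDiffAt hU hx
  have hgx := hg.contDiffAt (hU.mem_nhds hx)
  have dB : DifferentiableAt ℝ B x := differentiableAt_of_contDiffAt
    ((contDiffAt_frame hgx).clm_comp (hf.contDiffAt_frame_inverse hU hx))
  refine ⟨dB, ContinuousLinearMap.ext fun z => ContinuousLinearMap.ext fun y => ?_⟩
  obtain ⟨⟨v, t⟩, rfl⟩ := (hf.frame_bijective hx).2 y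
  have dframe := differentiableAt_of_contDiffAt (contDiffAt_frame hfx)
  have h := fderiv_apply_congr hU hx (fun y hy => hBf y hy (v, t)) z
  have hgaussf : fderiv ℝ (fderiv ℝ f) x z v + t • fderiv ℝ f x z
      = frame f x (inducedConn f x z v + t • z, -(ε * metric ε f x z v)) := by
    rw [hf.gauss hx, frame_apply, map_add, map_smul]
    module
  rw [fderiv_clm_apply_apply dB (dframe.clm_apply (differentiableAt_const _)),
    fderiv_clm_apply_apply dframe (differentiableAt_const _),
    fderiv_clm_apply_apply (differentiableAt_of_contDiffAt (contDiffAt_frame hgx))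
      (differentiableAt_const _), fderiv_const_apply, zero_apply, map_zero, map_zero, add_zero,
    add_zero, fderiv_frame hfx, fderiv_frame hgx, hgaussf, hBf x hx, hgauss x hx, frame_apply g,
    map_add, map_smul] at h
  rw [zero_apply, zero_apply]
  linear_combination (norm := module) h

theorem exists_apply_eq_of_gauss (hf : IsConvexCentroaffineOn ε f U) (hU : IsOpen U)
    (hUc : IsPreconnected U) (hg : ContDiffOn ℝ ∞ g U)
    (hgauss : ∀ x ∈ U, ∀ v w, fderiv ℝ (fderiv ℝ g) x v w
      = fderiv ℝ g x (inducedConn f x v w) - (ε * metric ε f x v w) • g x) :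
    ∃ β : F →L[ℝ] F', ∀ x ∈ U, β (f x) = g x := by
  have hB := fun x hx => hf.fderiv_frame_comp_inverse (x := x) hU hg hgauss hx
  obtain ⟨β, hβ⟩ := hU.exists_is_const_of_fderiv_eq_zero hUc
    (fun x hx => (hB x hx).1.differentiableWithinAt) (fun x hx => (hB x hx).2)
  refine ⟨β, fun x hx => ?_⟩
  calc β (f x) = β (frame f x (0, 1)) := by simp [frame_apply]
    _ = frame g x (0, 1) := by
      rw [← hβ x hx, ContinuousLinearMap.comp_apply,
        (hf.frame_isInvertible hx).inverse_apply_self]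
    _ = g x := by simp [frame_apply]

end IsConvexCentroaffineOn

end Rigidity

section PointSplitting

variable {E F F₁ : Type*} [NormedAddCommGroup E] [NormedSpace ℝ E]
  [NormedAddCommGroup F] [NormedSpace ℝ F] [NormedAddCommGroup F₁] [NormedSpace ℝ F₁]
  {ε : ℝ} {f : E → F} {U : Set E} {T : E → E} {a b : ℝ} {x : E}

/-- A splitting `A : F ≃ F₁ × ℝ` adapted to a principal field `T` with constant eigenvalues and
`∇̂K = 0`, together with the coordinate `u` of the Calabi product: `du = b h(T, ·)`, the second
component of `f` is `e^{(a - b) u / b}`, and the first one grows along `T` at the rate `b`. -/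
structure IsPointSplitting (ε : ℝ) (f : E → F) (U : Set E) (T : E → E) (a b : ℝ)
    (A : F ≃L[ℝ] F₁ × ℝ) (u : E → ℝ) : Prop
    extends IsPrincipalField ε f U T (fun _ => a) (fun _ => b) where
  parallel : HasParallelDiffTensorOn ε f U
  eps_eq : ε = b * (a - b)
  contDiffOn_coord : ContDiffOn ℝ ∞ u U
  fderiv_coord : ∀ x ∈ U, ∀ v, fderiv ℝ u x v = b * metric ε f x (T x) v
  fst_tangent : ∀ x ∈ U, (A (fderiv ℝ f x (T x))).1 = b • (A (f x)).1
  snd_apply : ∀ x ∈ U, (A (f x)).2 = Real.exp ((a - b) / b * u x)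

namespace IsPrincipalField

theorem axis_ne_zero (hT : IsPrincipalField ε f U T (fun _ => a) (fun _ => b)) (hx : x ∈ U)
    (c : ℝ) : axis ε c f T x ≠ 0 := by
  have hframe : axis ε c f T x = frame f x (c • T x, -ε) := by
    rw [frame_apply, map_smul, axis, neg_smul, sub_eq_add_neg]
  rw [hframe, (map_eq_zero_iff _ (hT.frame_bijective hx).1).ne]
  simp [hT.eps_ne_zero]

theorem coeff_ne_zero (hT : IsPrincipalField ε f U T (fun _ => a) (fun _ => b))
    (hε : ε = b * (a - b)) (hx : x ∈ U) : b ≠ 0 ∧ a - b ≠ 0 ∧ a - 2 * b ≠ 0 := by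
  have h := hT.eps_ne_zero
  rw [hε] at h
  exact ⟨left_ne_zero_of_mul h, right_ne_zero_of_mul h, sub_ne_zero.2 (hT.ne_two_mul x hx)⟩

theorem exists_nhds_apply_axis_pos (hT : IsPrincipalField ε f U T (fun _ => a) (fun _ => b))
    (hx : x ∈ U) (c : ℝ) :
    ∃ (W : Set E) (φ : F →L[ℝ] ℝ), IsOpen W ∧ IsPreconnected W ∧ x ∈ W ∧ W ⊆ U ∧
      φ (axis ε c f T x) = 1 ∧ ∀ y ∈ W, 0 < φ (axis ε c f T y) := by
  obtain ⟨φ, hφ⟩ := SeparatingDual.exists_eq_one (R := ℝ) (hT.axis_ne_zero hx c)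
  have hcont : ContinuousAt (fun y => φ (axis ε c f T y)) x :=
    φ.continuous.continuousAt.comp (hT.contDiffAt_axis hx c).continuousAt
  have hpos : ∀ᶠ y in nhds x, 0 < φ (axis ε c f T y) :=
    hcont.eventually (lt_mem_nhds (by simp [hφ]))
  obtain ⟨r, hr, hball⟩ := Metric.mem_nhds_iff.1 ((hT.isOpen.eventually_mem hx).and hpos)
  exact ⟨Metric.ball x r, φ, Metric.isOpen_ball, (convex_ball x r).isPreconnected,
    Metric.mem_ball_self hr, fun y hy => (hball hy).1, hφ, fun y hy => (hball hy).2⟩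

variable [FiniteDimensional ℝ E]

theorem metric_field_diffTensorL (hT : IsPrincipalField ε f U T (fun _ => a) (fun _ => b))
    (hx : x ∈ U) (v w : E) : metric ε f x (T x) (diffTensorL ε f x v w)
      = b * metric ε f x v w + (a - b) * metric ε f x (T x) v * metric ε f x (T x) w := by
  rw [hT.metric_comm hT.isOpen hx, hT.metric_diffTensorL_comm hT.isOpen hx,
    hT.diffTensorL_comm hT.isOpen hx, hT.diffTensorL_apply hx]
  simp

theorem fderiv_axis_eq_smul (hT : IsPrincipalField ε f U T (fun _ => a) (fun _ => b))
    (hK : HasParallelDiffTensorOn ε f U) (hε : ε = b * (a - b)) (hx : x ∈ U) (z : E) :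
    fderiv ℝ (axis ε (a - b) f T) x z
      = ((a - b) * metric ε f x (T x) z) • axis ε (a - b) f T x := by
  rw [hT.fderiv_axis hK hx, hε, mul_comm b, sub_self, zero_smul, zero_add]

theorem axis_gauss (hT : IsPrincipalField ε f U T (fun _ => a) (fun _ => b))
    (hK : HasParallelDiffTensorOn ε f U) (hε : ε = b * (a - b)) (hx : x ∈ U) (v w : E) :
    fderiv ℝ (fderiv ℝ (axis ε (a - b) f T)) x v w
      = fderiv ℝ (axis ε (a - b) f T) x (inducedConn f x v w)
        - (ε * metric ε f x v w) • axis ε (a - b) f T x := by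
  have dW := differentiableAt_of_contDiffAt (hT.contDiffAt_axis hx (a - b))
  have dW' := differentiableAt_of_contDiffAt (contDiffAt_fderiv (hT.contDiffAt_axis hx (a - b)))
  have dη : DifferentiableAt ℝ (fun y => metric ε f y (T y) w) x :=
    (differentiableAt_of_contDiffAt (hT.contDiffAt_dual hx)).clm_apply (differentiableAt_const w)
  have h := fderiv_apply_congr hT.isOpen hx (fun y hy => hT.fderiv_axis_eq_smul hK hε hy w) v
  rw [fderiv_clm_apply_apply dW' (differentiableAt_const w), fderiv_const_apply, zero_apply,
    map_zero, add_zero, fderiv_fun_smul (dη.const_mul (a - b)) dW, fderiv_const_mul dη, add_apply,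
    smul_apply, ContinuousLinearMap.smulRight_apply, smul_apply, hT.fderiv_dual_apply hK hx,
    hT.fderiv_axis_eq_smul hK hε hx] at h
  rw [hT.fderiv_axis_eq_smul hK hε hx, inducedConn_eq_add ε, map_add,
    hT.metric_field_diffTensorL hx]
  linear_combination (norm := module)
    h + congrArg (fun t => (t * metric ε f x v w) • axis ε (a - b) f T x) hε

theorem apply_axis_eq_smul (hT : IsPrincipalField ε f U T (fun _ => a) (fun _ => b))
    (hK : HasParallelDiffTensorOn ε f U) (hε : ε = b * (a - b)) {β : F →L[ℝ] F}
    (hβ : ∀ y ∈ U, β (f y) = axis ε (a - b) f T y) (hx : x ∈ U) :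
    β (axis ε (a - b) f T x) = ((a - b) * (a - 2 * b)) • axis ε (a - b) f T x := by
  have df := differentiableAt_of_contDiffAt (hT.contDiffAt hT.isOpen hx)
  have h := fderiv_apply_congr hT.isOpen hx (f := β ∘ f) hβ (T x)
  rw [(β.hasFDerivAt.comp x df.hasFDerivAt).fderiv, ContinuousLinearMap.comp_apply,
    hT.fderiv_axis_eq_smul hK hε hx, hT.metric_self x hx] at h
  nth_rw 1 [axis]
  rw [map_sub, map_smul, map_smul, h, hβ x hx]
  linear_combination (norm := module) congrArg (fun t => -t • axis ε (a - b) f T x) hε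

/- The axis solves the Gauss equation of `f`, so `axis = β ∘ f` with `β` linear. As the axis has a
constant direction `w`, the second component of `A` has to be the multiple of `φ ∘ β` with
value `1` at `w`. -/
theorem exists_equiv_prod_axis [FiniteDimensional ℝ F₁]
    (hT : IsPrincipalField ε f U T (fun _ => a) (fun _ => b))
    (hK : HasParallelDiffTensorOn ε f U) (hε : ε = b * (a - b))
    (hF : Module.finrank ℝ F = Module.finrank ℝ F₁ + 1) (hU : IsPreconnected U)
    {φ : F →L[ℝ] ℝ} (hφ : ∀ y ∈ U, 0 < φ (axis ε (a - b) f T y)) (hx : x ∈ U) :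
    ∃ A : F ≃L[ℝ] F₁ × ℝ, ∀ y ∈ U,
      (A (axis ε (a - b) f T y)).1 = 0 ∧ (A (f y)).2 = φ (axis ε (a - b) f T y) := by
  set P := axis ε (a - b) f T
  obtain ⟨β, hβ⟩ := hT.exists_apply_eq_of_gauss hT.isOpen hU
    (fun y hy => (hT.contDiffAt_axis hy (a - b)).contDiffWithinAt)
    (fun y hy => hT.axis_gauss hK hε hy)
  obtain ⟨-, hab, hab'⟩ := hT.coeff_ne_zero hε hx
  set k := (a - b) * (a - 2 * b) * φ (P x) with hk
  have hk0 : k ≠ 0 := mul_ne_zero (mul_ne_zero hab hab') (hφ x hx).ne'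
  obtain ⟨A, hA₂, hA₁⟩ := exists_equiv_prod (E₁ := F₁) hF (φ.comp β) (t := k⁻¹ • P x) (by
    rw [ContinuousLinearMap.comp_apply, map_smul, hT.apply_axis_eq_smul hK hε hβ hx, map_smul,
      map_smul, smul_eq_mul, smul_eq_mul, ← hk, inv_mul_cancel₀ hk0])
  refine ⟨A, fun y hy => ⟨?_, by rw [hA₂, ContinuousLinearMap.comp_apply, hβ y hy]⟩⟩
  have hPx : (A (P x)).1 = 0 := by simpa [hk0] using hA₁
  have hPy : φ (P x) • (A (P y)).1 = 0 := by
    rw [← Prod.smul_fst, ← map_smul, smul_apply_eq_of_fderiv_eq_smul hT.isOpen hU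
      (fun z hz => (differentiableAt_of_contDiffAt
        (hT.contDiffAt_axis hz (a - b))).differentiableWithinAt)
      (fun z hz => hT.fderiv_axis_eq_smul hK hε hz) (fun z hz => (hφ z hz).ne') hy hx,
      map_smul, Prod.smul_fst, hPx, smul_zero]
  exact (smul_eq_zero.1 hPy).resolve_left (hφ x hx).ne'

theorem isPointSplitting (hT : IsPrincipalField ε f U T (fun _ => a) (fun _ => b))
    (hK : HasParallelDiffTensorOn ε f U) (hε : ε = b * (a - b)) {φ : F →L[ℝ] ℝ}
    (hφ : ∀ y ∈ U, 0 < φ (axis ε (a - b) f T y)) {A : F ≃L[ℝ] F₁ × ℝ}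
    (hA : ∀ y ∈ U,
      (A (axis ε (a - b) f T y)).1 = 0 ∧ (A (f y)).2 = φ (axis ε (a - b) f T y)) :
    IsPointSplitting ε f U T a b A
      (fun y => b / (a - b) * Real.log (φ (axis ε (a - b) f T y))) := by
  have hsmooth : ∀ x ∈ U, ContDiffAt ℝ ∞ (fun y => φ (axis ε (a - b) f T y)) x := fun x hx =>
    φ.contDiff.contDiffAt.comp x (hT.contDiffAt_axis hx (a - b))
  refine ⟨hT, hK, hε, fun x hx => ?_, fun x hx v => ?_, fun x hx => ?_, fun x hx => ?_⟩
  · exact (contDiffAt_const.mul ((hsmooth x hx).log (hφ x hx).ne')).contDiffWithinAt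
  · obtain ⟨-, hab, -⟩ := hT.coeff_ne_zero hε hx
    have hφx := (hφ x hx).ne'
    have dφ := differentiableAt_of_contDiffAt (hsmooth x hx)
    have hdφ := (φ.hasFDerivAt.comp x (differentiableAt_of_contDiffAt
      (hT.contDiffAt_axis hx (a - b))).hasFDerivAt).fderiv
    rw [Function.comp_def] at hdφ
    rw [fderiv_const_mul (dφ.log hφx), fderiv.log dφ hφx, hdφ]
    simp only [smul_apply, ContinuousLinearMap.comp_apply, hT.fderiv_axis_eq_smul hK hε hx,
      map_smul, smul_eq_mul]
    field_simp
  · obtain ⟨-, hab, -⟩ := hT.coeff_ne_zero hε hx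
    have h := (hA x hx).1
    rw [axis, map_sub, map_smul, map_smul, Prod.fst_sub, Prod.smul_fst, Prod.smul_fst, hε,
      mul_comm b, mul_smul, ← smul_sub, smul_eq_zero] at h
    exact sub_eq_zero.1 (h.resolve_left hab)
  · obtain ⟨hb, hab, -⟩ := hT.coeff_ne_zero hε hx
    rw [(hA x hx).2, ← mul_assoc, div_mul_div_cancel₀ hb, div_self hab, one_mul,
      Real.exp_log (hφ x hx)]

theorem exists_isPointSplitting [FiniteDimensional ℝ F₁]
    (hT : IsPrincipalField ε f U T (fun _ => a) (fun _ => b))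
    (hK : HasParallelDiffTensorOn ε f U) (hε : ε = b * (a - b))
    (hF : Module.finrank ℝ F = Module.finrank ℝ F₁ + 1) (hx : x ∈ U) :
    ∃ (W : Set E) (A : F ≃L[ℝ] F₁ × ℝ) (u : E → ℝ),
      x ∈ W ∧ W ⊆ U ∧ u x = 0 ∧ IsPointSplitting ε f W T a b A u := by
  obtain ⟨W, φ, hW, hWc, hxW, hWU, hφx, hφ⟩ := hT.exists_nhds_apply_axis_pos hx (a - b)
  have hTW := hT.mono hW hWU
  obtain ⟨A, hA⟩ := hTW.exists_equiv_prod_axis (hK.mono hWU) hε hF hWc hφ hxW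
  exact ⟨W, A, _, hxW, hWU, by simp [hφx], hTW.isPointSplitting (hK.mono hWU) hε hφ hA⟩

end IsPrincipalField

end PointSplitting

/-! ### The hypersurface factor -/

section ChainRule

variable {E E₁ G H : Type*} [NormedAddCommGroup E] [NormedSpace ℝ E]
  [NormedAddCommGroup E₁] [NormedSpace ℝ E₁] [NormedAddCommGroup G] [NormedSpace ℝ G]
  [NormedAddCommGroup H] [NormedSpace ℝ H] {ι : E₁ → E} {p : E₁}

theorem fderiv_comp_apply {f : E → G} (hf : DifferentiableAt ℝ f (ι p))
    (hι : DifferentiableAt ℝ ι p) (v : E₁) :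
    fderiv ℝ (fun q => f (ι q)) p v = fderiv ℝ f (ι p) (fderiv ℝ ι p v) := by
  rw [fderiv_fun_comp p hf hι, ContinuousLinearMap.comp_apply]

theorem fderiv_pullback_apply {η : E → E →L[ℝ] G} (hη : DifferentiableAt ℝ η (ι p))
    (hι : ContDiffAt ℝ ∞ ι p) (z v : E₁) :
    fderiv ℝ (fun q => η (ι q) (fderiv ℝ ι q v)) p z
      = fderiv ℝ η (ι p) (fderiv ℝ ι p z) (fderiv ℝ ι p v)
        + η (ι p) (fderiv ℝ (fderiv ℝ ι) p z v) := by
  have dι := differentiableAt_of_contDiffAt hι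
  have dι' := differentiableAt_of_contDiffAt (contDiffAt_fderiv hι)
  rw [fderiv_clm_apply_apply (hη.fun_comp' p dι) (dι'.clm_apply (differentiableAt_const v)),
    fderiv_comp_apply hη dι, fderiv_clm_apply_apply dι' (differentiableAt_const v)]
  simp

theorem fderiv_pullback₂_apply {B : E → E →L[ℝ] G →L[ℝ] H} {Y : E₁ → G}
    (hB : DifferentiableAt ℝ B (ι p)) (hι : ContDiffAt ℝ ∞ ι p) (hY : DifferentiableAt ℝ Y p)
    (z v : E₁) :
    fderiv ℝ (fun q => B (ι q) (fderiv ℝ ι q v) (Y q)) p z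
      = fderiv ℝ B (ι p) (fderiv ℝ ι p z) (fderiv ℝ ι p v) (Y p)
        + B (ι p) (fderiv ℝ (fderiv ℝ ι) p z v) (Y p)
        + B (ι p) (fderiv ℝ ι p v) (fderiv ℝ Y p z) := by
  have dι := differentiableAt_of_contDiffAt hι
  have dι' := differentiableAt_of_contDiffAt (contDiffAt_fderiv hι)
  rw [fderiv_clm_apply_apply ((hB.fun_comp' p dι).clm_apply
    (dι'.clm_apply (differentiableAt_const v))) hY, fderiv_pullback_apply hB hι, add_apply]

theorem fderiv_fderiv_comp {f : E → G} (hf : ContDiffAt ℝ ∞ f (ι p)) (hι : ContDiffAt ℝ ∞ ι p)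
    (v w : E₁) :
    fderiv ℝ (fderiv ℝ (fun q => f (ι q))) p v w
      = fderiv ℝ (fderiv ℝ f) (ι p) (fderiv ℝ ι p v) (fderiv ℝ ι p w)
        + fderiv ℝ f (ι p) (fderiv ℝ (fderiv ℝ ι) p v w) := by
  have hι₁ : ∀ᶠ q in nhds p, ContDiffAt ℝ 1 ι q :=
    (hι.of_le (by exact_mod_cast le_top)).eventually (by simp)
  have hf₁ : ∀ᶠ q in nhds p, ContDiffAt ℝ 1 f (ι q) := hι.continuousAt.eventually
    ((hf.of_le (by exact_mod_cast le_top)).eventually (by simp))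
  have hcomp : (fun q => fderiv ℝ (fun q => f (ι q)) q w)
      =ᶠ[nhds p] fun q => fderiv ℝ f (ι q) (fderiv ℝ ι q w) := by
    filter_upwards [hι₁, hf₁] with q hιq hfq using
      fderiv_comp_apply (hfq.differentiableAt (by simp)) (hιq.differentiableAt (by simp)) w
  have dfι' : DifferentiableAt ℝ (fderiv ℝ fun q => f (ι q)) p :=
    differentiableAt_of_contDiffAt (contDiffAt_fderiv (hf.comp p hι))
  have h := congrArg (fun L : E₁ →L[ℝ] G => L v) hcomp.fderiv_eq
  rw [fderiv_pullback_apply (differentiableAt_of_contDiffAt (contDiffAt_fderiv hf)) hι,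
    fderiv_clm_apply_apply dfι' (differentiableAt_const w)] at h
  simpa using h

end ChainRule

section Slice

variable {E F E₁ F₁ : Type*} [NormedAddCommGroup E] [NormedSpace ℝ E]
  [NormedAddCommGroup F] [NormedSpace ℝ F] [NormedAddCommGroup E₁] [NormedSpace ℝ E₁]
  [NormedAddCommGroup F₁] [NormedSpace ℝ F₁] {ε : ℝ} {f : E → F} {U : Set E} {T : E → E} {a b : ℝ}
  {A : F ≃L[ℝ] F₁ × ℝ} {u : E → ℝ} {V : Set E₁} {ι : E₁ → E} {x : E} {p : E₁}

theorem IsConvexCentroaffineOn.leviCivitaL_unique [FiniteDimensional ℝ E]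
    (hf : IsConvexCentroaffineOn ε f U) (hU : IsOpen U) (hx : x ∈ U) {Γ : E → E → E}
    (hΓ : ∀ v w, Γ v w = Γ w v)
    (hmetric : ∀ z v w, fderiv ℝ (metric ε f) x z v w
      = metric ε f x (Γ z v) w + metric ε f x v (Γ z w)) (v w : E) :
    leviCivitaL ε f x v w = Γ v w :=
  hf.eq_of_metric hx fun z => by
    rw [hf.koszul hx, hmetric, hmetric, hmetric, hΓ w v, hΓ z v, hΓ z w,
      hf.metric_comm hU hx v (Γ w z), hf.metric_comm hU hx w (Γ v z)]
    ring

namespace IsPointSplitting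

theorem snd_tangent (hA : IsPointSplitting ε f U T a b A u) (hx : x ∈ U) (v : E) :
    (A (fderiv ℝ f x v)).2 = (a - b) * metric ε f x (T x) v * (A (f x)).2 := by
  obtain ⟨hb, -, -⟩ := hA.coeff_ne_zero hA.eps_eq hx
  have df := differentiableAt_of_contDiffAt (hA.contDiffAt hA.isOpen hx)
  have du := differentiableAt_of_contDiffAt (hA.contDiffOn_coord.contDiffAt (hA.isOpen.mem_nhds hx))
  have h := fderiv_apply_congr hA.isOpen hx
    (f := (ContinuousLinearMap.snd ℝ F₁ ℝ).comp (A : F →L[ℝ] F₁ × ℝ) ∘ f) hA.snd_apply v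
  rw [(ContinuousLinearMap.hasFDerivAt _).comp x df.hasFDerivAt |>.fderiv,
    (du.hasFDerivAt.const_mul _).exp.fderiv] at h
  simp only [ContinuousLinearMap.comp_apply, smul_apply, hA.fderiv_coord x hx, smul_eq_mul] at h
  rw [hA.snd_apply x hx]
  calc (A (fderiv ℝ f x v)).2 = _ := h
    _ = _ := by field_simp

theorem exists_eq_smul_of_fst_eq_zero (hA : IsPointSplitting ε f U T a b A u) (hx : x ∈ U)
    {y : F} (hy : (A y).1 = 0) : ∃ s : ℝ, y = s • (fderiv ℝ f x (T x) - b • f x) := by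
  obtain ⟨-, -, hab⟩ := hA.coeff_ne_zero hA.eps_eq hx
  have hne : (A (f x)).2 ≠ 0 := by
    rw [hA.snd_apply x hx]
    exact Real.exp_ne_zero _
  refine ⟨(A y).2 / ((a - 2 * b) * (A (f x)).2), A.injective (Prod.ext ?_ ?_)⟩
  · simp [hy, hA.fst_tangent x hx]
  · simp only [map_smul, map_sub, Prod.smul_snd, Prod.snd_sub, hA.snd_tangent hx,
      hA.metric_self x hx, smul_eq_mul]
    field_simp
    ring

end IsPointSplitting

/-- `ι` parametrizes over `V` a hypersurface of `U` which is `h`-orthogonal to the field `T`, that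
is, an integral hypersurface of the second distribution. -/
structure IsOrthogonalSlice (ε : ℝ) (f : E → F) (U : Set E) (T : E → E) (V : Set E₁)
    (ι : E₁ → E) : Prop where
  isOpen : IsOpen V
  contDiffOn : ContDiffOn ℝ ∞ ι V
  mapsTo : Set.MapsTo ι V U
  immersion : ∀ p ∈ V, Function.Injective (fderiv ℝ ι p)
  mem_range_iff :
    ∀ p ∈ V, ∀ v, v ∈ Set.range (fderiv ℝ ι p) ↔ metric ε f (ι p) (T (ι p)) v = 0

/-- The first factor of `f` in the splitting `A`, along the slice `ι`. It is the hypersurface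
factor of the Calabi product. -/
def sliceFactor (A : F ≃L[ℝ] F₁ × ℝ) (f : E → F) (ι : E₁ → E) (p : E₁) : F₁ :=
  (A (f (ι p))).1

namespace IsOrthogonalSlice

theorem contDiffAt (hι : IsOrthogonalSlice ε f U T V ι) (hp : p ∈ V) : ContDiffAt ℝ ∞ ι p :=
  hι.contDiffOn.contDiffAt (hι.isOpen.mem_nhds hp)

theorem differentiableAt_fderiv_apply (hι : IsOrthogonalSlice ε f U T V ι) (hp : p ∈ V) (v : E₁) :
    DifferentiableAt ℝ (fun q => fderiv ℝ ι q v) p :=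
  (differentiableAt_of_contDiffAt (contDiffAt_fderiv (hι.contDiffAt hp))).clm_apply
    (differentiableAt_const v)

theorem fderiv_fderiv_apply (hι : IsOrthogonalSlice ε f U T V ι) (hp : p ∈ V) (z v : E₁) :
    fderiv ℝ (fun q => fderiv ℝ ι q v) p z = fderiv ℝ (fderiv ℝ ι) p z v := by
  rw [fderiv_clm_apply_apply (differentiableAt_of_contDiffAt (contDiffAt_fderiv
    (hι.contDiffAt hp))) (differentiableAt_const v)]
  simp

theorem metric_field_fderiv (hι : IsOrthogonalSlice ε f U T V ι) (hp : p ∈ V) (v : E₁) :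
    metric ε f (ι p) (T (ι p)) (fderiv ℝ ι p v) = 0 :=
  (hι.mem_range_iff p hp _).1 ⟨v, rfl⟩

variable [FiniteDimensional ℝ E]

/-- The slice is totally geodesic. -/
theorem exists_fderiv_eq_leviCivitaL_add (hι : IsOrthogonalSlice ε f U T V ι)
    (hT : IsPrincipalField ε f U T (fun _ => a) (fun _ => b)) (hK : HasParallelDiffTensorOn ε f U)
    (hp : p ∈ V) (v w : E₁) :
    ∃ z, fderiv ℝ ι p z = leviCivitaL ε f (ι p) (fderiv ℝ ι p v) (fderiv ℝ ι p w)
      + fderiv ℝ (fderiv ℝ ι) p v w := by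
  refine (hι.mem_range_iff p hp _).2 ?_
  have hx := hι.mapsTo hp
  have h := fderiv_apply_congr hι.isOpen hp (fun q hq => hι.metric_field_fderiv hq w) v
  rwa [fderiv_pullback_apply (η := fun x => metric ε f x (T x))
    (differentiableAt_of_contDiffAt (hT.contDiffAt_dual hx)) (hι.contDiffAt hp),
    hT.fderiv_dual hK hx, ← map_add, fderiv_const_apply, zero_apply] at h

theorem exists_fderiv_eq_inducedConn_add (hι : IsOrthogonalSlice ε f U T V ι)
    (hT : IsPrincipalField ε f U T (fun _ => a) (fun _ => b)) (hK : HasParallelDiffTensorOn ε f U)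
    (hp : p ∈ V) (v w : E₁) :
    ∃ z, fderiv ℝ ι p z = inducedConn f (ι p) (fderiv ℝ ι p v) (fderiv ℝ ι p w)
      + fderiv ℝ (fderiv ℝ ι) p v w
      - (b * metric ε f (ι p) (fderiv ℝ ι p v) (fderiv ℝ ι p w)) • T (ι p) := by
  refine (hι.mem_range_iff p hp _).2 ?_
  have hx := hι.mapsTo hp
  obtain ⟨z, hz⟩ := hι.exists_fderiv_eq_leviCivitaL_add hT hK hp v w
  have h := hι.metric_field_fderiv hp z
  rw [hz, map_add] at h
  rw [inducedConn_eq_add ε, map_sub, map_smul, map_add, map_add, hT.metric_self _ hx,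
    hT.metric_field_diffTensorL hx, hι.metric_field_fderiv hp, smul_eq_mul]
  linarith

end IsOrthogonalSlice

namespace IsPointSplitting

theorem eps_sub_sq_ne_zero (hA : IsPointSplitting ε f U T a b A u) (hx : x ∈ U) :
    ε - b ^ 2 ≠ 0 := by
  obtain ⟨hb, -, hab⟩ := hA.coeff_ne_zero hA.eps_eq hx
  have h : ε - b ^ 2 = b * (a - 2 * b) := by
    rw [hA.eps_eq]
    ring
  exact h ▸ mul_ne_zero hb hab

theorem sign_eq_one_or_neg_one (hA : IsPointSplitting ε f U T a b A u) (hx : x ∈ U) :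
    (SignType.sign (ε - b ^ 2) : ℝ) = 1 ∨ (SignType.sign (ε - b ^ 2) : ℝ) = -1 := by
  rcases (hA.eps_sub_sq_ne_zero hx).lt_or_gt with h | h <;> simp [h]

theorem contDiffAt_sliceFactor (hA : IsPointSplitting ε f U T a b A u)
    (hι : IsOrthogonalSlice ε f U T V ι) (hp : p ∈ V) :
    ContDiffAt ℝ ∞ (sliceFactor A f ι) p :=
  contDiff_fst.contDiffAt.comp p (A.contDiff.contDiffAt.comp p
    ((hA.contDiffAt hA.isOpen (hι.mapsTo hp)).comp p (hι.contDiffAt hp)))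

theorem fderiv_sliceFactor (hA : IsPointSplitting ε f U T a b A u)
    (hι : IsOrthogonalSlice ε f U T V ι) (hp : p ∈ V) (v : E₁) :
    fderiv ℝ (sliceFactor A f ι) p v = (A (fderiv ℝ f (ι p) (fderiv ℝ ι p v))).1 := by
  have df := differentiableAt_of_contDiffAt (hA.contDiffAt hA.isOpen (hι.mapsTo hp))
  have h := ((ContinuousLinearMap.fst ℝ F₁ ℝ).comp (A : F →L[ℝ] F₁ × ℝ)).hasFDerivAt.comp p
    (df.hasFDerivAt.comp p (differentiableAt_of_contDiffAt (hι.contDiffAt hp)).hasFDerivAt)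
  exact DFunLike.congr_fun h.fderiv v

theorem fderiv_fderiv_sliceFactor (hA : IsPointSplitting ε f U T a b A u)
    (hι : IsOrthogonalSlice ε f U T V ι) (hp : p ∈ V) (v w : E₁) :
    fderiv ℝ (fderiv ℝ (sliceFactor A f ι)) p v w
      = (A (fderiv ℝ (fderiv ℝ f) (ι p) (fderiv ℝ ι p v) (fderiv ℝ ι p w)
        + fderiv ℝ f (ι p) (fderiv ℝ (fderiv ℝ ι) p v w))).1 := by
  have hfx := hA.contDiffAt hA.isOpen (hι.mapsTo hp)
  let L := (ContinuousLinearMap.fst ℝ F₁ ℝ).comp (A : F →L[ℝ] F₁ × ℝ)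
  have hL : fderiv ℝ (fun y => L y) = fun _ => L := funext fun y => L.fderiv
  have h := fderiv_fderiv_comp (f := fun y => L y) L.contDiff.contDiffAt
    (hfx.comp p (hι.contDiffAt hp)) v w
  rw [hL, fderiv_fun_const] at h
  rw [← fderiv_fderiv_comp hfx (hι.contDiffAt hp)]
  simp only [Pi.zero_apply, zero_apply, zero_add] at h
  exact h

theorem frame_sliceFactor_apply (hA : IsPointSplitting ε f U T a b A u)
    (hι : IsOrthogonalSlice ε f U T V ι) (hp : p ∈ V) (v : E₁) (t : ℝ) :
    frame (sliceFactor A f ι) p (v, t) = (A (frame f (ι p) (fderiv ℝ ι p v, t))).1 := by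
  rw [frame_apply, frame_apply, hA.fderiv_sliceFactor hι hp, map_add, map_smul, Prod.fst_add,
    Prod.smul_fst, sliceFactor]

theorem frame_sliceFactor_injective (hA : IsPointSplitting ε f U T a b A u)
    (hι : IsOrthogonalSlice ε f U T V ι) (hp : p ∈ V) :
    Function.Injective (frame (sliceFactor A f ι) p) := by
  have hx := hι.mapsTo hp
  rw [injective_iff_map_eq_zero]
  rintro ⟨v, t⟩ h
  rw [hA.frame_sliceFactor_apply hι hp] at h
  obtain ⟨s, hs⟩ := hA.exists_eq_smul_of_fst_eq_zero hx h
  have hframe : frame f (ι p) (fderiv ℝ ι p v, t) = frame f (ι p) (s • T (ι p), -(s * b)) := by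
    rw [hs, frame_apply, map_smul]
    module
  obtain ⟨hv, ht⟩ := Prod.mk.inj ((hA.frame_bijective hx).1 hframe)
  have hs0 := hι.metric_field_fderiv hp v
  rw [hv, map_smul, hA.metric_self _ hx, smul_eq_mul, mul_one] at hs0
  rw [hs0, zero_smul] at hv
  rw [hs0, zero_mul, neg_zero] at ht
  rw [(map_eq_zero_iff _ (hι.immersion p hp)).1 hv, ht, Prod.mk_zero_zero]

theorem frame_sliceFactor_surjective (hA : IsPointSplitting ε f U T a b A u)
    (hι : IsOrthogonalSlice ε f U T V ι) (hp : p ∈ V) :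
    Function.Surjective (frame (sliceFactor A f ι) p) := by
  intro y
  have hx := hι.mapsTo hp
  obtain ⟨⟨e, t⟩, he⟩ := (hA.frame_bijective hx).2 (A.symm (y, 0))
  set s := metric ε f (ι p) (T (ι p)) e with hs
  obtain ⟨v, hv⟩ := (hι.mem_range_iff p hp (e - s • T (ι p))).2 (by
    rw [map_sub, map_smul, hA.metric_self _ hx, ← hs, smul_eq_mul, mul_one, sub_self])
  refine ⟨(v, t + s * b), ?_⟩
  have hA_tangent := hA.fst_tangent _ hx
  have hy : y = (A (frame f (ι p) (e, t))).1 := by rw [he, A.apply_symm_apply]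
  rw [hA.frame_sliceFactor_apply hι hp, hv, hy]
  simp only [frame_apply, map_add, map_sub, map_smul, Prod.fst_add, Prod.fst_sub, Prod.smul_fst,
    hA_tangent]
  module

theorem frame_sliceFactor_bijective (hA : IsPointSplitting ε f U T a b A u)
    (hι : IsOrthogonalSlice ε f U T V ι) (hp : p ∈ V) :
    Function.Bijective (frame (sliceFactor A f ι) p) :=
  ⟨hA.frame_sliceFactor_injective hι hp, hA.frame_sliceFactor_surjective hι hp⟩

variable [FiniteDimensional ℝ E]

theorem sliceFactor_gauss (hA : IsPointSplitting ε f U T a b A u)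
    (hι : IsOrthogonalSlice ε f U T V ι) (hp : p ∈ V) {v w z : E₁}
    (hz : fderiv ℝ ι p z = inducedConn f (ι p) (fderiv ℝ ι p v) (fderiv ℝ ι p w)
      + fderiv ℝ (fderiv ℝ ι) p v w
      - (b * metric ε f (ι p) (fderiv ℝ ι p v) (fderiv ℝ ι p w)) • T (ι p)) :
    fderiv ℝ (fderiv ℝ (sliceFactor A f ι)) p v w = fderiv ℝ (sliceFactor A f ι) p z
      - ((ε - b ^ 2) * metric ε f (ι p) (fderiv ℝ ι p v) (fderiv ℝ ι p w))
        • sliceFactor A f ι p := by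
  have hx := hι.mapsTo hp
  rw [hA.fderiv_fderiv_sliceFactor hι hp, hA.fderiv_sliceFactor hι hp, hz, hA.gauss hx]
  simp only [map_add, map_sub, map_smul, Prod.fst_add, Prod.fst_sub, Prod.smul_fst,
    hA.fst_tangent _ hx, sliceFactor]
  module

variable [FiniteDimensional ℝ E₁]

theorem metric_sliceFactor_and_fderiv_inducedConn (hA : IsPointSplitting ε f U T a b A u)
    (hι : IsOrthogonalSlice ε f U T V ι) (hp : p ∈ V) (v w : E₁) :
    metric (SignType.sign (ε - b ^ 2)) (sliceFactor A f ι) p v w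
        = |ε - b ^ 2| * metric ε f (ι p) (fderiv ℝ ι p v) (fderiv ℝ ι p w) ∧
      fderiv ℝ ι p (inducedConn (sliceFactor A f ι) p v w)
        = inducedConn f (ι p) (fderiv ℝ ι p v) (fderiv ℝ ι p w) + fderiv ℝ (fderiv ℝ ι) p v w
          - (b * metric ε f (ι p) (fderiv ℝ ι p v) (fderiv ℝ ι p w)) • T (ι p) := by
  obtain ⟨z, hz⟩ := hι.exists_fderiv_eq_inducedConn_add hA.toIsPrincipalField hA.parallel hp v w
  have hgauss := hA.sliceFactor_gauss hι hp hz
  rw [← sign_mul_abs (ε - b ^ 2), mul_assoc] at hgauss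
  obtain ⟨hmetric, hconn⟩ := metric_eq_of_gauss
    (hA.sign_eq_one_or_neg_one (hι.mapsTo hp)) (hA.frame_sliceFactor_bijective hι hp) hgauss
  exact ⟨hmetric, hconn ▸ hz⟩

theorem metric_sliceFactor (hA : IsPointSplitting ε f U T a b A u)
    (hι : IsOrthogonalSlice ε f U T V ι) (hp : p ∈ V) (v w : E₁) :
    metric (SignType.sign (ε - b ^ 2)) (sliceFactor A f ι) p v w
      = |ε - b ^ 2| * metric ε f (ι p) (fderiv ℝ ι p v) (fderiv ℝ ι p w) :=
  (hA.metric_sliceFactor_and_fderiv_inducedConn hι hp v w).1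

theorem fderiv_inducedConn_sliceFactor (hA : IsPointSplitting ε f U T a b A u)
    (hι : IsOrthogonalSlice ε f U T V ι) (hp : p ∈ V) (v w : E₁) :
    fderiv ℝ ι p (inducedConn (sliceFactor A f ι) p v w)
      = inducedConn f (ι p) (fderiv ℝ ι p v) (fderiv ℝ ι p w) + fderiv ℝ (fderiv ℝ ι) p v w
        - (b * metric ε f (ι p) (fderiv ℝ ι p v) (fderiv ℝ ι p w)) • T (ι p) :=
  (hA.metric_sliceFactor_and_fderiv_inducedConn hι hp v w).2

theorem isConvexCentroaffineOn_sliceFactor (hA : IsPointSplitting ε f U T a b A u)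
    (hι : IsOrthogonalSlice ε f U T V ι) (hV : V.Nonempty) :
    IsConvexCentroaffineOn (SignType.sign (ε - b ^ 2)) (sliceFactor A f ι) V := by
  have hframe := fun p hp =>
    frame_bijective_iff.1 (hA.frame_sliceFactor_bijective hι (p := p) hp)
  obtain ⟨q, hq⟩ := hV
  refine ⟨hA.sign_eq_one_or_neg_one (hι.mapsTo hq),
    fun p hp => (hA.contDiffAt_sliceFactor hι hp).contDiffWithinAt,
    fun p hp => (hframe p hp).1, fun p hp => (hframe p hp).2.1,
    fun p hp => (hframe p hp).2.2, fun p hp v hv => ?_⟩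
  rw [hA.metric_sliceFactor hι hp]
  have hιv : fderiv ℝ ι p v ≠ 0 := (map_ne_zero_iff _ (hι.immersion p hp)).2 hv
  exact mul_pos (abs_pos.2 (hA.eps_sub_sq_ne_zero (hι.mapsTo hp)))
    (hA.posDef _ (hι.mapsTo hp) _ hιv)

theorem fderiv_metric_sliceFactor (hA : IsPointSplitting ε f U T a b A u)
    (hι : IsOrthogonalSlice ε f U T V ι) (hp : p ∈ V) (z v w : E₁) :
    fderiv ℝ (metric (SignType.sign (ε - b ^ 2)) (sliceFactor A f ι)) p z v w
      = |ε - b ^ 2|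
        * (metric ε f (ι p) (leviCivitaL ε f (ι p) (fderiv ℝ ι p z) (fderiv ℝ ι p v)
            + fderiv ℝ (fderiv ℝ ι) p z v) (fderiv ℝ ι p w)
          + metric ε f (ι p) (fderiv ℝ ι p v)
            (leviCivitaL ε f (ι p) (fderiv ℝ ι p z) (fderiv ℝ ι p w)
              + fderiv ℝ (fderiv ℝ ι) p z w)) := by
  have hx := hι.mapsTo hp
  have hf₁ := hA.isConvexCentroaffineOn_sliceFactor hι ⟨p, hp⟩
  have dmetric := hA.differentiableAt_metric hx
  have dpullback := ((dmetric.fun_comp' p (differentiableAt_of_contDiffAt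
    (hι.contDiffAt hp))).clm_apply (hι.differentiableAt_fderiv_apply hp v)).clm_apply
    (hι.differentiableAt_fderiv_apply hp w)
  have h := fderiv_apply_congr hι.isOpen hp (fun q hq => hA.metric_sliceFactor hι hq v w) z
  rw [fderiv_clm_apply₂_const_apply (differentiableAt_of_contDiffAt
      (hf₁.contDiffAt_metric hι.isOpen hp)), fderiv_const_mul dpullback, smul_apply,
    fderiv_pullback₂_apply dmetric (hι.contDiffAt hp) (hι.differentiableAt_fderiv_apply hp w),
    hι.fderiv_fderiv_apply hp, hA.fderiv_metric hA.isOpen hx] at h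
  rw [h, map_add, map_add, add_apply, smul_eq_mul]
  ring

theorem fderiv_leviCivitaL_sliceFactor (hA : IsPointSplitting ε f U T a b A u)
    (hι : IsOrthogonalSlice ε f U T V ι) (hp : p ∈ V) (v w : E₁) :
    fderiv ℝ ι p (leviCivitaL (SignType.sign (ε - b ^ 2)) (sliceFactor A f ι) p v w)
      = leviCivitaL ε f (ι p) (fderiv ℝ ι p v) (fderiv ℝ ι p w)
        + fderiv ℝ (fderiv ℝ ι) p v w := by
  choose Γ hΓ using hι.exists_fderiv_eq_leviCivitaL_add hA.toIsPrincipalField hA.parallel hp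
  have hΓ_comm : ∀ v w, Γ v w = Γ w v := fun v w => hι.immersion p hp <| by
    rw [hΓ, hΓ, hA.leviCivitaL_comm hA.isOpen (hι.mapsTo hp),
      fderiv_fderiv_comm (hι.contDiffAt hp) v w]
  have hΓ_metric : ∀ z v w,
      fderiv ℝ (metric (SignType.sign (ε - b ^ 2)) (sliceFactor A f ι)) p z v w
        = metric (SignType.sign (ε - b ^ 2)) (sliceFactor A f ι) p (Γ z v) w
          + metric (SignType.sign (ε - b ^ 2)) (sliceFactor A f ι) p v (Γ z w) := fun z v w => by
    rw [hA.fderiv_metric_sliceFactor hι hp, hA.metric_sliceFactor hι hp,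
      hA.metric_sliceFactor hι hp, hΓ, hΓ, mul_add]
  rw [(hA.isConvexCentroaffineOn_sliceFactor hι ⟨p, hp⟩).leviCivitaL_unique hι.isOpen hp hΓ_comm
    hΓ_metric, hΓ]

theorem cubicForm_sliceFactor (hA : IsPointSplitting ε f U T a b A u)
    (hι : IsOrthogonalSlice ε f U T V ι) (hp : p ∈ V) (v w z : E₁) :
    cubicForm (SignType.sign (ε - b ^ 2)) (sliceFactor A f ι) p v w z
      = (-2 * |ε - b ^ 2|) * metric ε f (ι p)
        (diffTensorL ε f (ι p) (fderiv ℝ ι p v) (fderiv ℝ ι p w)) (fderiv ℝ ι p z) := by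
  have hdiffTensor :
      fderiv ℝ ι p (diffTensorL (SignType.sign (ε - b ^ 2)) (sliceFactor A f ι) p v w)
        = diffTensorL ε f (ι p) (fderiv ℝ ι p v) (fderiv ℝ ι p w)
          - (b * metric ε f (ι p) (fderiv ℝ ι p v) (fderiv ℝ ι p w)) • T (ι p) := by
    rw [diffTensorL, sub_apply, sub_apply, map_sub, hA.fderiv_inducedConn_sliceFactor hι hp,
      hA.fderiv_leviCivitaL_sliceFactor hι hp, inducedConn_eq_add ε]
    abel
  rw [(hA.isConvexCentroaffineOn_sliceFactor hι ⟨p, hp⟩).cubicForm_eq hι.isOpen hp,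
    hA.metric_sliceFactor hι hp, hdiffTensor, map_sub, map_smul, sub_apply, smul_apply,
    hι.metric_field_fderiv hp, smul_zero, sub_zero, mul_assoc]

/- The cubic form of the factor is the restriction of a multiple of `h(K(·, ·), ·)`, which is
parallel, and the slice is totally geodesic. -/
theorem covDerivCubicForm_sliceFactor (hA : IsPointSplitting ε f U T a b A u)
    (hι : IsOrthogonalSlice ε f U T V ι) (hp : p ∈ V) (y v w z : E₁) :
    covDerivCubicForm (SignType.sign (ε - b ^ 2)) (sliceFactor A f ι) p y v w z = 0 := by
  have hx := hι.mapsTo hp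
  have dι := differentiableAt_of_contDiffAt (hι.contDiffAt hp)
  have dmetric := hA.differentiableAt_metric hx
  have dK := hA.differentiableAt_diffTensorL hx
  have dKι : DifferentiableAt ℝ
      (fun q => diffTensorL ε f (ι q) (fderiv ℝ ι q v) (fderiv ℝ ι q w)) p :=
    ((dK.fun_comp' p dι).clm_apply (hι.differentiableAt_fderiv_apply hp v)).clm_apply
      (hι.differentiableAt_fderiv_apply hp w)
  have dz := hι.differentiableAt_fderiv_apply hp z
  have dC := ((dmetric.fun_comp' p dι).clm_apply dKι).clm_apply dz
  rw [covDerivCubicForm,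
    fderiv_apply_congr hι.isOpen hp (fun q hq => hA.cubicForm_sliceFactor hι hq v w z),
    fderiv_const_mul dC, smul_apply, fderiv_clm_apply₂_apply (dmetric.fun_comp' p dι) dKι dz,
    fderiv_comp_apply dmetric dι, fderiv_pullback₂_apply dK (hι.contDiffAt hp)
      (hι.differentiableAt_fderiv_apply hp w), hι.fderiv_fderiv_apply hp,
    hι.fderiv_fderiv_apply hp, hA.fderiv_metric hA.isOpen hx,
    hA.fderiv_diffTensorL hA.isOpen hA.parallel hx]
  simp only [hA.cubicForm_sliceFactor hι hp, ← leviCivitaL_apply,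
    hA.fderiv_leviCivitaL_sliceFactor hι hp, smul_eq_mul, map_add, map_sub, add_apply, sub_apply]
  ring

end IsPointSplitting

end Slice

/-! ### Adapted charts -/

section InverseFunction

variable {E G : Type*} [NormedAddCommGroup E] [NormedSpace ℝ E]
  [NormedAddCommGroup G] [NormedSpace ℝ G] {W : Set E} {x : E}

theorem fderiv_symm_apply_fderiv {Φ : OpenPartialHomeomorph E G} (hx : x ∈ Φ.source)
    (hΦ : DifferentiableAt ℝ Φ x) (hΦ' : DifferentiableAt ℝ Φ.symm (Φ x)) (v : E) :
    fderiv ℝ Φ.symm (Φ x) (fderiv ℝ Φ x v) = v := by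
  rw [← fderiv_comp_apply hΦ' hΦ,
    fderiv_apply_congr (g := fun y => y) Φ.open_source hx (fun y hy => Φ.left_inv hy),
    fderiv_fun_id]
  rfl

theorem exists_openPartialHomeomorph_contDiffOn_symm [CompleteSpace E] {f : E → G}
    (hW : IsOpen W) (hf : ContDiffOn ℝ ∞ f W) (hx : x ∈ W) (hinv : (fderiv ℝ f x).IsInvertible) :
    ∃ Φ : OpenPartialHomeomorph E G, ⇑Φ = f ∧ x ∈ Φ.source ∧ Φ.source ⊆ W ∧
      ContDiffOn ℝ ∞ Φ.symm Φ.target := by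
  have hfx := fun y hy => hf.contDiffAt (hW.mem_nhds (x := y) hy)
  have hderiv := fun y hy => (differentiableAt_of_contDiffAt (hfx y hy)).hasFDerivAt
  have hS : {y | y ∈ W ∧ (fderiv ℝ f y).IsInvertible} ∈ nhds x :=
    Filter.inter_mem (hW.mem_nhds hx)
      ((contDiffAt_fderiv (hfx x hx)).continuousAt (ContinuousLinearEquiv.isOpen.mem_nhds hinv))
  obtain ⟨e, he⟩ := hinv
  have hex : HasFDerivAt f (e : E →L[ℝ] G) x := he ▸ hderiv x hx
  let ρ := (hfx x hx).toOpenPartialHomeomorph f hex (by simp)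
  refine ⟨ρ.restr {y | y ∈ W ∧ (fderiv ℝ f y).IsInvertible}, rfl,
    ⟨(hfx x hx).mem_toOpenPartialHomeomorph_source hex (by simp), mem_interior_iff_mem_nhds.2 hS⟩,
    fun y hy => (interior_subset hy.2).1, fun y hy => ?_⟩
  obtain ⟨hyW, e', he'⟩ := interior_subset hy.2
  exact (ρ.contDiffAt_symm (f₀' := e') hy.1 (he' ▸ hderiv _ hyW) (hfx _ hyW)).contDiffWithinAt

end InverseFunction

theorem exists_openPartialHomeomorph_target_eq_prod {X Y Z : Type*} [TopologicalSpace X]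
    [PseudoMetricSpace Y] [PseudoMetricSpace Z] (ρ : OpenPartialHomeomorph X (Y × Z)) {x : X}
    (hx : x ∈ ρ.source) :
    ∃ (Φ : OpenPartialHomeomorph X (Y × Z)) (r : ℝ), 0 < r ∧ ⇑Φ = ρ ∧ ⇑Φ.symm = ρ.symm ∧
      x ∈ Φ.source ∧ Φ.source ⊆ ρ.source ∧ Φ.target ⊆ ρ.target ∧
      Φ.target = Metric.ball (ρ x).1 r ×ˢ Metric.ball (ρ x).2 r := by
  obtain ⟨r, hr, hball⟩ :=
    Metric.mem_nhds_iff.1 (ρ.open_target.mem_nhds (ρ.map_source hx))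
  exact ⟨(ρ.symm.restrOpen (Metric.ball (ρ x) r) Metric.isOpen_ball).symm, r, hr, rfl, rfl,
    ⟨hx, Metric.mem_ball_self hr⟩, fun y hy => hy.1, fun y hy => hy.1,
    (Set.inter_eq_right.2 hball).trans (ball_prod_same ..).symm⟩

section AdaptedChart

variable {E F E₁ F₁ : Type*} [NormedAddCommGroup E] [NormedSpace ℝ E]
  [NormedAddCommGroup F] [NormedSpace ℝ F] [NormedAddCommGroup E₁] [NormedSpace ℝ E₁]
  [NormedAddCommGroup F₁] [NormedSpace ℝ F₁] {ε : ℝ} {f : E → F} {U : Set E} {T : E → E} {a b : ℝ}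
  {A : F ≃L[ℝ] F₁ × ℝ} {u : E → ℝ} {x : E}

theorem exists_isInvertible_prod_comp [FiniteDimensional ℝ E₁] [FiniteDimensional ℝ F₁]
    (hdim : Module.finrank ℝ E = Module.finrank ℝ E₁ + 1) {η : E →L[ℝ] ℝ} {D : E →L[ℝ] F₁} {t : E}
    (hη : η t = 1) (hD : D t = 0) (hinj : ∀ v, η v = 0 → D v = 0 → v = 0) :
    ∃ π : F₁ →L[ℝ] E₁, (η.prod (π.comp D)).IsInvertible := by
  obtain ⟨L, hLη, hLt⟩ := exists_equiv_prod (E₁ := E₁) hdim η hη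
  let j : E₁ →ₗ[ℝ] F₁ := D.toLinearMap ∘ₗ L.symm.toLinearMap ∘ₗ LinearMap.inl ℝ E₁ ℝ
  have hj : ∀ v, D v = j (L v).1 := fun v => by
    have hv : v = L.symm ((L v).1, 0) + (L v).2 • t := L.injective (Prod.ext
      (by simp [hLt]) (by simp [hLη, hη]))
    conv_lhs => rw [hv, map_add, map_smul, hD, smul_zero, add_zero]
    rfl
  have hker : LinearMap.ker j = ⊥ := by
    refine LinearMap.ker_eq_bot'.2 fun w hw => ?_
    have h := hinj (L.symm (w, 0)) (by rw [← hLη, L.apply_symm_apply]) hw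
    exact congrArg Prod.fst ((map_eq_zero_iff _ L.symm.injective).1 h)
  obtain ⟨π, hπ⟩ := j.exists_leftInverse_of_injective hker
  refine ⟨π.toContinuousLinearMap, L.trans (ContinuousLinearEquiv.prodComm ℝ E₁ ℝ), ?_⟩
  ext v
  · exact hLη v
  · exact (DFunLike.congr_fun hπ (L v).1).symm.trans (congrArg π (hj v).symm)

/-- The first factor of `f` in the splitting `A`, rescaled by `e^{-u}`. It is constant along `T`. -/
noncomputable def rescaledFactor (A : F ≃L[ℝ] F₁ × ℝ) (f : E → F) (u : E → ℝ) (x : E) : F₁ :=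
  Real.exp (-u x) • (A (f x)).1

/-- `Φ` is a chart with values in a product of an interval and an open set `V`, whose first
coordinate is `u` and whose other coordinates are constant along `T`, where `du(T) = b`. -/
structure IsAdaptedChart (u : E → ℝ) (T : E → E) (b r : ℝ) (V : Set E₁)
    (Φ : OpenPartialHomeomorph E (ℝ × E₁)) : Prop where
  isOpen : IsOpen V
  pos : 0 < r
  target_eq : Φ.target = Metric.ball 0 r ×ˢ V
  contDiffOn : ContDiffOn ℝ ∞ Φ Φ.source
  contDiffOn_symm : ContDiffOn ℝ ∞ Φ.symm Φ.target
  fst_apply : ∀ x ∈ Φ.source, (Φ x).1 = u x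
  fderiv_field : ∀ x ∈ Φ.source, fderiv ℝ Φ x (T x) = (b, 0)

namespace IsPointSplitting

theorem contDiffAt_coord (hA : IsPointSplitting ε f U T a b A u) (hx : x ∈ U) :
    ContDiffAt ℝ ∞ u x :=
  hA.contDiffOn_coord.contDiffAt (hA.isOpen.mem_nhds hx)

theorem contDiffAt_rescaledFactor (hA : IsPointSplitting ε f U T a b A u) (hx : x ∈ U) :
    ContDiffAt ℝ ∞ (rescaledFactor A f u) x :=
  (hA.contDiffAt_coord hx).neg.exp.smul
    (contDiff_fst.contDiffAt.comp x (A.contDiff.contDiffAt.comp x (hA.contDiffAt hA.isOpen hx)))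

theorem fderiv_rescaledFactor (hA : IsPointSplitting ε f U T a b A u) (hx : x ∈ U) (v : E) :
    fderiv ℝ (rescaledFactor A f u) x v = Real.exp (-u x) •
      ((A (fderiv ℝ f x v)).1 - (b * metric ε f x (T x) v) • (A (f x)).1) := by
  have df := differentiableAt_of_contDiffAt (hA.contDiffAt hA.isOpen hx)
  have du := differentiableAt_of_contDiffAt (hA.contDiffAt_coord hx)
  have hfst := ((ContinuousLinearMap.fst ℝ F₁ ℝ).comp (A : F →L[ℝ] F₁ × ℝ)).hasFDerivAt.comp x
    df.hasFDerivAt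
  have h := DFunLike.congr_fun (du.hasFDerivAt.neg.exp.smul hfst).fderiv v
  simp only [add_apply, smul_apply, ContinuousLinearMap.smulRight_apply, neg_apply,
    hA.fderiv_coord x hx, ContinuousLinearMap.comp_apply, Pi.neg_apply, smul_eq_mul] at h
  refine Eq.trans h ?_
  simp only [Function.comp_apply, ContinuousLinearMap.comp_apply, ContinuousLinearMap.coe_fst',
    ContinuousLinearEquiv.coe_coe]
  module

theorem fderiv_rescaledFactor_field (hA : IsPointSplitting ε f U T a b A u) (hx : x ∈ U) :
    fderiv ℝ (rescaledFactor A f u) x (T x) = 0 := by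
  rw [hA.fderiv_rescaledFactor hx, hA.fst_tangent x hx, hA.metric_self x hx, mul_one, sub_self,
    smul_zero]

theorem eq_zero_of_fderiv_eq_zero (hA : IsPointSplitting ε f U T a b A u) (hx : x ∈ U) {v : E}
    (hu : fderiv ℝ u x v = 0) (hv : fderiv ℝ (rescaledFactor A f u) x v = 0) : v = 0 := by
  obtain ⟨hb, -, -⟩ := hA.coeff_ne_zero hA.eps_eq hx
  rw [hA.fderiv_coord x hx] at hu
  have hηv := (mul_eq_zero.1 hu).resolve_left hb
  rw [hA.fderiv_rescaledFactor hx, hu, zero_smul, sub_zero] at hv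
  have hfst : (A (fderiv ℝ f x v)).1 = 0 := (smul_eq_zero.1 hv).resolve_left (Real.exp_ne_zero _)
  have hsnd : (A (fderiv ℝ f x v)).2 = 0 := by
    rw [hA.snd_tangent hx, hηv, mul_zero, zero_mul]
  exact (map_eq_zero_iff _ (hA.immersion x hx)).1
    ((map_eq_zero_iff _ A.injective).1 (Prod.ext hfst hsnd))

theorem exists_isInvertible_fderiv [FiniteDimensional ℝ E₁] [FiniteDimensional ℝ F₁]
    (hA : IsPointSplitting ε f U T a b A u)
    (hdim : Module.finrank ℝ E = Module.finrank ℝ E₁ + 1) (hx : x ∈ U) :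
    ∃ π : F₁ →L[ℝ] E₁,
      ((fderiv ℝ u x).prod (π.comp (fderiv ℝ (rescaledFactor A f u) x))).IsInvertible := by
  obtain ⟨hb, -, -⟩ := hA.coeff_ne_zero hA.eps_eq hx
  refine exists_isInvertible_prod_comp hdim (t := b⁻¹ • T x) ?_ ?_
    fun v => hA.eq_zero_of_fderiv_eq_zero hx
  · rw [map_smul, hA.fderiv_coord x hx, hA.metric_self x hx, mul_one, smul_eq_mul,
      inv_mul_cancel₀ hb]
  · rw [map_smul, hA.fderiv_rescaledFactor_field hx, smul_zero]

theorem exists_isAdaptedChart [FiniteDimensional ℝ E] [FiniteDimensional ℝ E₁]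
    [FiniteDimensional ℝ F₁] (hA : IsPointSplitting ε f U T a b A u)
    (hdim : Module.finrank ℝ E = Module.finrank ℝ E₁ + 1) (hx : x ∈ U) (hux : u x = 0) :
    ∃ (r : ℝ) (V : Set E₁) (Φ : OpenPartialHomeomorph E (ℝ × E₁)),
      x ∈ Φ.source ∧ Φ.source ⊆ U ∧ IsAdaptedChart u T b r V Φ := by
  obtain ⟨π, hπ⟩ := hA.exists_isInvertible_fderiv hdim hx
  have hderiv : ∀ y ∈ U, HasFDerivAt (fun y => (u y, π (rescaledFactor A f u y)))
      ((fderiv ℝ u y).prod (π.comp (fderiv ℝ (rescaledFactor A f u) y))) y := fun y hy =>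
    (differentiableAt_of_contDiffAt (hA.contDiffAt_coord hy)).hasFDerivAt.prodMk
      (π.hasFDerivAt.comp y
        (differentiableAt_of_contDiffAt (hA.contDiffAt_rescaledFactor hy)).hasFDerivAt)
  have hsmooth : ContDiffOn ℝ ∞ (fun y => (u y, π (rescaledFactor A f u y))) U := fun y hy =>
    ((hA.contDiffAt_coord hy).prodMk
      (π.contDiff.contDiffAt.comp y (hA.contDiffAt_rescaledFactor hy))).contDiffWithinAt
  obtain ⟨ρ, hρ, hxρ, hρU, hρ'⟩ := exists_openPartialHomeomorph_contDiffOn_symm hA.isOpen hsmooth hx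
    ((hderiv x hx).fderiv ▸ hπ)
  obtain ⟨Φ, r, hr, hΦ, hΦ', hxΦ, hΦρ, hΦρ', htarget⟩ :=
    exists_openPartialHomeomorph_target_eq_prod ρ hxρ
  have hΦU := hΦρ.trans hρU
  have hρx : (ρ x).1 = 0 := by
    rw [hρ]
    exact hux
  refine ⟨r, Metric.ball (ρ x).2 r, Φ, hxΦ, hΦU, Metric.isOpen_ball, hr, ?_, ?_, ?_, ?_, ?_⟩
  · rw [htarget, hρx]
  · rw [hΦ, hρ]
    exact hsmooth.mono hΦU
  · rw [hΦ']
    exact hρ'.mono hΦρ'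
  · rw [hΦ, hρ]
    exact fun y _ => rfl
  · intro y hy
    rw [hΦ, hρ, (hderiv y (hΦU hy)).fderiv, ContinuousLinearMap.prod_apply,
      ContinuousLinearMap.comp_apply, hA.fderiv_rescaledFactor_field (hΦU hy), map_zero,
      hA.fderiv_coord y (hΦU hy), hA.metric_self y (hΦU hy), mul_one]

end IsPointSplitting

namespace IsAdaptedChart

variable {r : ℝ} {V : Set E₁} {Φ : OpenPartialHomeomorph E (ℝ × E₁)} {y : ℝ × E₁} {p : E₁}

theorem slice_mem_target (hΦ : IsAdaptedChart u T b r V Φ) (hp : p ∈ V) : (0, p) ∈ Φ.target :=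
  hΦ.target_eq ▸ ⟨Metric.mem_ball_self hΦ.pos, hp⟩

theorem contDiffAt (hΦ : IsAdaptedChart u T b r V Φ) (hx : x ∈ Φ.source) : ContDiffAt ℝ ∞ Φ x :=
  hΦ.contDiffOn.contDiffAt (Φ.open_source.mem_nhds hx)

theorem contDiffAt_symm (hΦ : IsAdaptedChart u T b r V Φ) (hy : y ∈ Φ.target) :
    ContDiffAt ℝ ∞ Φ.symm y :=
  hΦ.contDiffOn_symm.contDiffAt (Φ.open_target.mem_nhds hy)

theorem fderiv_symm_fderiv (hΦ : IsAdaptedChart u T b r V Φ) (hx : x ∈ Φ.source) (v : E) :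
    fderiv ℝ Φ.symm (Φ x) (fderiv ℝ Φ x v) = v :=
  fderiv_symm_apply_fderiv hx (differentiableAt_of_contDiffAt (hΦ.contDiffAt hx))
    (differentiableAt_of_contDiffAt (hΦ.contDiffAt_symm (Φ.map_source hx))) v

theorem fderiv_fderiv_symm (hΦ : IsAdaptedChart u T b r V Φ) (hy : y ∈ Φ.target) (v : ℝ × E₁) :
    fderiv ℝ Φ (Φ.symm y) (fderiv ℝ Φ.symm y v) = v :=
  fderiv_symm_apply_fderiv (Φ := Φ.symm) hy
    (differentiableAt_of_contDiffAt (hΦ.contDiffAt_symm hy))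
    (differentiableAt_of_contDiffAt (hΦ.contDiffAt (Φ.map_target hy))) v

theorem fst_fderiv (hΦ : IsAdaptedChart u T b r V Φ) (hx : x ∈ Φ.source) (v : E) :
    (fderiv ℝ Φ x v).1 = fderiv ℝ u x v := by
  rw [← fderiv_apply_congr Φ.open_source hx hΦ.fst_apply,
    (differentiableAt_of_contDiffAt (hΦ.contDiffAt hx)).hasFDerivAt.fst.fderiv]
  rfl

theorem hasFDerivAt_slice (hΦ : IsAdaptedChart u T b r V Φ) (hp : p ∈ V) :
    HasFDerivAt (fun q => Φ.symm (0, q))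
      ((fderiv ℝ Φ.symm (0, p)).comp (ContinuousLinearMap.inr ℝ ℝ E₁)) p :=
  (differentiableAt_of_contDiffAt (hΦ.contDiffAt_symm (hΦ.slice_mem_target hp))).hasFDerivAt.comp p
    (hasFDerivAt_prodMk_right (0 : ℝ) p)

theorem fderiv_slice (hΦ : IsAdaptedChart u T b r V Φ) (hp : p ∈ V) (v : E₁) :
    fderiv ℝ (fun q => Φ.symm (0, q)) p v = fderiv ℝ Φ.symm (0, p) (0, v) := by
  rw [(hΦ.hasFDerivAt_slice hp).fderiv]
  rfl

theorem hasDerivAt_symm_left (hΦ : IsAdaptedChart u T b r V Φ) (hb : b ≠ 0) (hy : y ∈ Φ.target) :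
    HasDerivAt (fun s => Φ.symm (s, y.2)) (b⁻¹ • T (Φ.symm y)) y.1 := by
  have hT : fderiv ℝ Φ.symm y (1, 0) = b⁻¹ • T (Φ.symm y) := by
    have h := hΦ.fderiv_symm_fderiv (Φ.map_target hy) (b⁻¹ • T (Φ.symm y))
    rwa [map_smul, hΦ.fderiv_field _ (Φ.map_target hy), Φ.right_inv hy, Prod.smul_mk, smul_zero,
      smul_eq_mul, inv_mul_cancel₀ hb] at h
  rw [← hT]
  exact (differentiableAt_of_contDiffAt (hΦ.contDiffAt_symm hy)).hasFDerivAt.comp_hasDerivAt y.1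
    ((hasDerivAt_id y.1).prodMk (hasDerivAt_const y.1 y.2))

end IsAdaptedChart

end AdaptedChart

section CalabiDecomposition

variable {E F E₁ F₁ : Type*} [NormedAddCommGroup E] [NormedSpace ℝ E]
  [NormedAddCommGroup F] [NormedSpace ℝ F] [NormedAddCommGroup E₁] [NormedSpace ℝ E₁]
  [NormedAddCommGroup F₁] [NormedSpace ℝ F₁] {ε : ℝ} {f : E → F} {U : Set E} {T : E → E}
  {a b r : ℝ} {A : F ≃L[ℝ] F₁ × ℝ} {u : E → ℝ} {V : Set E₁}
  {Φ : OpenPartialHomeomorph E (ℝ × E₁)} {x : E}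

/-- `f` is, up to the linear isomorphism `A` and the chart `Φ`, the Calabi product with parameter
`c` of a point and the hypersurface `ψ₁` over `V`, which is locally strongly convex with parallel
cubic form. -/
structure IsCalabiDecomposition (f : E → F) (c ε₁ r : ℝ) (V : Set E₁) (ψ₁ : E₁ → F₁)
    (A : F ≃L[ℝ] F₁ × ℝ) (Φ : OpenPartialHomeomorph E (ℝ × E₁)) : Prop
    extends IsConvexCentroaffineOn ε₁ ψ₁ V where
  ne_zero_param : c ≠ 0
  ne_neg_one_param : c ≠ -1
  isOpen : IsOpen V
  covDerivCubicForm_eq_zero : ∀ p ∈ V, ∀ z u v w, covDerivCubicForm ε₁ ψ₁ p z u v w = 0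
  target_eq : Φ.target = Metric.ball 0 r ×ˢ V
  contDiffOn : ContDiffOn ℝ ∞ Φ Φ.source
  contDiffOn_symm : ContDiffOn ℝ ∞ Φ.symm Φ.target
  apply_eq : ∀ x ∈ Φ.source, A (f x) = calabiPoint c ψ₁ (Φ x)

namespace IsPointSplitting

theorem isOrthogonalSlice (hA : IsPointSplitting ε f U T a b A u)
    (hΦ : IsAdaptedChart u T b r V Φ) (hΦU : Φ.source ⊆ U) (hb : b ≠ 0) :
    IsOrthogonalSlice ε f U T V (fun p => Φ.symm (0, p)) := by
  have hsource := fun p hp => Φ.map_target (hΦ.slice_mem_target (p := p) hp)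
  have hfst : ∀ p ∈ V, ∀ v, metric ε f (Φ.symm (0, p)) (T (Φ.symm (0, p))) v = 0 ↔
      (fderiv ℝ Φ (Φ.symm (0, p)) v).1 = 0 := fun p hp v => by
    rw [hΦ.fst_fderiv (hsource p hp), hA.fderiv_coord _ (hΦU (hsource p hp)), mul_eq_zero,
      or_iff_right hb]
  refine ⟨hΦ.isOpen, fun p hp => ?_, fun p hp => hΦU (hsource p hp), fun p hp v w h => ?_,
    fun p hp v => ?_⟩
  · exact ((hΦ.contDiffAt_symm (hΦ.slice_mem_target hp)).comp p
      (contDiffAt_const.prodMk contDiffAt_id)).contDiffWithinAt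
  · rw [hΦ.fderiv_slice hp, hΦ.fderiv_slice hp] at h
    have h' := congrArg (fderiv ℝ Φ (Φ.symm (0, p))) h
    rw [hΦ.fderiv_fderiv_symm (hΦ.slice_mem_target hp),
      hΦ.fderiv_fderiv_symm (hΦ.slice_mem_target hp)] at h'
    exact congrArg Prod.snd h'
  · rw [hfst p hp]
    constructor
    · rintro ⟨w, rfl⟩
      rw [hΦ.fderiv_slice hp, hΦ.fderiv_fderiv_symm (hΦ.slice_mem_target hp)]
    · intro hv
      refine ⟨(fderiv ℝ Φ (Φ.symm (0, p)) v).2, ?_⟩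
      have h := hΦ.fderiv_symm_fderiv (hsource p hp) v
      rwa [Φ.right_inv (hΦ.slice_mem_target hp), ← Prod.mk.eta (p := fderiv ℝ Φ _ v), hv,
        ← hΦ.fderiv_slice hp] at h

theorem rescaledFactor_eq_sliceFactor (hA : IsPointSplitting ε f U T a b A u)
    (hΦ : IsAdaptedChart u T b r V Φ) (hΦU : Φ.source ⊆ U) (hb : b ≠ 0) (hx : x ∈ Φ.source) :
    rescaledFactor A f u x = sliceFactor A f (fun p => Φ.symm (0, p)) (Φ x).2 := by
  have hΦx : Φ x ∈ Metric.ball 0 r ×ˢ V := hΦ.target_eq ▸ Φ.map_source hx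
  have hderiv : ∀ s ∈ Metric.ball 0 r,
      HasDerivAt (fun s => rescaledFactor A f u (Φ.symm (s, (Φ x).2))) 0 s := fun s hs => by
    have hy : (s, (Φ x).2) ∈ Φ.target := hΦ.target_eq ▸ ⟨hs, hΦx.2⟩
    have hyU := hΦU (Φ.map_target hy)
    have h := (differentiableAt_of_contDiffAt
      (hA.contDiffAt_rescaledFactor hyU)).hasFDerivAt.comp_hasDerivAt s
      (hΦ.hasDerivAt_symm_left hb hy)
    rwa [map_smul, hA.fderiv_rescaledFactor_field hyU, smul_zero] at h
  have hconst := Metric.isOpen_ball.is_const_of_deriv_eq_zero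
    (convex_ball (0 : ℝ) r).isPreconnected
    (fun s hs => (hderiv s hs).differentiableAt.differentiableWithinAt)
    (fun s hs => (hderiv s hs).deriv) hΦx.1 (Metric.mem_ball_self hΦ.pos)
  have hslice := hΦ.slice_mem_target hΦx.2
  have hu : u (Φ.symm (0, (Φ x).2)) = 0 := by
    rw [← hΦ.fst_apply _ (Φ.map_target hslice), Φ.right_inv hslice]
  rw [Prod.mk.eta, Φ.left_inv hx] at hconst
  rw [hconst, rescaledFactor, hu, neg_zero, Real.exp_zero, one_smul, sliceFactor]

theorem apply_eq_calabiPoint (hA : IsPointSplitting ε f U T a b A u)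
    (hΦ : IsAdaptedChart u T b r V Φ) (hΦU : Φ.source ⊆ U) (hb : b ≠ 0) (hx : x ∈ Φ.source) :
    A (f x) = calabiPoint (-((a - b) / b)) (sliceFactor A f fun p => Φ.symm (0, p)) (Φ x) := by
  rw [calabiPoint, ← hA.rescaledFactor_eq_sliceFactor hΦ hΦU hb hx, hΦ.fst_apply x hx,
    rescaledFactor, smul_smul, ← Real.exp_add, add_neg_cancel, Real.exp_zero, one_smul, neg_neg,
    ← hA.snd_apply x (hΦU hx)]

theorem isCalabiDecomposition [FiniteDimensional ℝ E] [FiniteDimensional ℝ E₁]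
    (hA : IsPointSplitting ε f U T a b A u) (hΦ : IsAdaptedChart u T b r V Φ)
    (hΦU : Φ.source ⊆ U) (hx : x ∈ Φ.source) :
    IsCalabiDecomposition f (-((a - b) / b)) (SignType.sign (ε - b ^ 2)) r V
      (sliceFactor A f fun p => Φ.symm (0, p)) A Φ := by
  obtain ⟨hb, hab, hab'⟩ := hA.coeff_ne_zero hA.eps_eq (hΦU hx)
  have hι := hA.isOrthogonalSlice hΦ hΦU hb
  have hV : V.Nonempty := ⟨(Φ x).2, (hΦ.target_eq ▸ Φ.map_source hx : Φ x ∈ _ ×ˢ V).2⟩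
  refine ⟨hA.isConvexCentroaffineOn_sliceFactor hι hV, neg_ne_zero.2 (div_ne_zero hab hb), ?_,
    hΦ.isOpen, fun p hp => hA.covDerivCubicForm_sliceFactor hι hp, hΦ.target_eq, hΦ.contDiffOn,
    hΦ.contDiffOn_symm, fun y hy => hA.apply_eq_calabiPoint hΦ hΦU hb hy⟩
  rw [Ne, neg_inj, div_eq_one_iff_eq hb]
  intro h
  exact hab' (by linarith)

end IsPointSplitting

theorem IsPrincipalField.exists_isCalabiDecomposition [FiniteDimensional ℝ E₁]
    [FiniteDimensional ℝ F₁] (hT : IsPrincipalField ε f U T (fun _ => a) (fun _ => b))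
    (hK : HasParallelDiffTensorOn ε f U) (hε : ε = b * (a - b))
    (hE : Module.finrank ℝ E = Module.finrank ℝ E₁ + 1)
    (hF : Module.finrank ℝ F = Module.finrank ℝ F₁ + 1) (hx : x ∈ U) :
    ∃ (c ε₁ r : ℝ) (V : Set E₁) (ψ₁ : E₁ → F₁) (A : F ≃L[ℝ] F₁ × ℝ)
      (Φ : OpenPartialHomeomorph E (ℝ × E₁)),
      x ∈ Φ.source ∧ Φ.source ⊆ U ∧ IsCalabiDecomposition f c ε₁ r V ψ₁ A Φ := by
  have : FiniteDimensional ℝ E := Module.finite_of_finrank_pos (by omega)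
  obtain ⟨W, A, u, hxW, hWU, hux, hA⟩ := hT.exists_isPointSplitting hK hε hF hx
  obtain ⟨r, V, Φ, hxΦ, hΦW, hΦ⟩ := hA.exists_isAdaptedChart hE hxW hux
  exact ⟨_, _, r, V, _, A, Φ, hxΦ, hΦW.trans hWU, hA.isCalabiDecomposition hΦ hΦW hxΦ⟩

end CalabiDecomposition

/-! ### Hypersurfaces on a manifold -/

section Manifold

theorem map_eq_ker_of_finrank_add_one {V W : Type*} [AddCommGroup V] [Module ℝ V]
    [AddCommGroup W] [Module ℝ W] [FiniteDimensional ℝ W] {A : V →ₗ[ℝ] W}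
    (hA : Function.Injective A) {D : Submodule ℝ V} {η : W →ₗ[ℝ] ℝ} (hη : η ≠ 0)
    (hD : ∀ v ∈ D, η (A v) = 0) (hdim : Module.finrank ℝ D + 1 = Module.finrank ℝ W) :
    D.map A = LinearMap.ker η := by
  have hle : D.map A ≤ LinearMap.ker η := Submodule.map_le_iff_le_comap.2 hD
  refine Submodule.eq_of_le_of_finrank_eq hle ?_
  have hker := Module.Dual.finrank_ker_add_one_of_ne_zero hη
  have hmap := (Submodule.equivMapOfInjective A hA D).finrank_eq
  omega

variable {n : ℕ} {M : Type*} [TopologicalSpace M] [ChartedSpace (EuclideanSpace ℝ (Fin n)) M]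

theorem IsCalabiDecomposition.isCalabiProductWithPointNear [IsManifold (𝓡 n) ∞ M]
    {ψ : M → EuclideanSpace ℝ (Fin (n + 1))} {p₀ : M} {c ε₁ r : ℝ}
    {V : Set (EuclideanSpace ℝ (Fin (n - 1)))}
    {ψ₁ : EuclideanSpace ℝ (Fin (n - 1)) → EuclideanSpace ℝ (Fin n)}
    {A : EuclideanSpace ℝ (Fin (n + 1)) ≃L[ℝ] (EuclideanSpace ℝ (Fin n) × ℝ)}
    {Φ : OpenPartialHomeomorph (EuclideanSpace ℝ (Fin n)) (ℝ × EuclideanSpace ℝ (Fin (n - 1)))}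
    (h : IsCalabiDecomposition (coordRep ψ p₀) c ε₁ r V ψ₁ A Φ)
    (hΦ : Φ.source ⊆ (extChartAt (𝓡 n) p₀).target) (hp₀ : extChartAt (𝓡 n) p₀ p₀ ∈ Φ.source) :
    IsCalabiProductWithPointNear ψ p₀ := by
  let e := chartAt (EuclideanSpace ℝ (Fin n)) p₀
  have htarget : (e.trans Φ).target = Φ.target :=
    Set.inter_eq_left.2 fun y hy => by simpa using hΦ (Φ.map_target hy)
  refine ⟨c, ε₁, 0 - r, 0 + r, V, ψ₁, A, e.trans Φ, h.ne_zero_param, h.ne_neg_one_param, h.isOpen,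
    h.toIsConvexCentroaffineOn, h.covDerivCubicForm_eq_zero, ⟨mem_chart_source _ p₀, hp₀⟩,
    by rw [htarget, h.target_eq, Real.ball_eq_Ioo], ?_, ?_, fun q hq => ?_⟩
  · exact h.contDiffOn.contMDiffOn.comp
      ((contMDiffOn_extChartAt (I := 𝓡 n) (x := p₀)).mono Set.inter_subset_left) fun q hq => hq.2
  · rw [htarget]
    exact (contMDiffOn_extChartAt_symm (I := 𝓡 n) p₀).comp h.contDiffOn_symm.contMDiffOn
      fun y hy => hΦ (Φ.map_target hy)
  · have hψ : coordRep ψ p₀ (e q) = ψ q :=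
      congrArg ψ ((extChartAt (𝓡 n) p₀).left_inv (by rw [extChartAt_source]; exact hq.1))
    rw [← hψ]
    exact h.apply_eq (e q) hq.2

theorem metricAt_extChartAt_symm {F : Type*} [NormedAddCommGroup F] [NormedSpace ℝ F] (ε : ℝ)
    (ψ : M → F) (p : M) {x : EuclideanSpace ℝ (Fin n)} (hx : x ∈ (extChartAt (𝓡 n) p).target)
    (v w : TangentSpace (𝓡 n) ((extChartAt (𝓡 n) p).symm x)) :
    metricAt ε ψ p ((extChartAt (𝓡 n) p).symm x) v w
      = metric ε (coordRep ψ p) x (coordVec p _ v) (coordVec p _ w) := by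
  rw [metricAt, (extChartAt (𝓡 n) p).right_inv hx]

theorem diffTensorAt_extChartAt_symm {F : Type*} [NormedAddCommGroup F] [NormedSpace ℝ F] (ε : ℝ)
    (ψ : M → F) (p : M) {x : EuclideanSpace ℝ (Fin n)} (hx : x ∈ (extChartAt (𝓡 n) p).target)
    (v w : TangentSpace (𝓡 n) ((extChartAt (𝓡 n) p).symm x)) :
    diffTensorAt ε ψ p ((extChartAt (𝓡 n) p).symm x) v w
      = diffTensorL ε (coordRep ψ p) x (coordVec p _ v) (coordVec p _ w) := by
  rw [diffTensorAt, (extChartAt (𝓡 n) p).right_inv hx, diffTensorL_apply]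

variable [IsManifold (𝓡 n) ∞ M]

theorem contDiffOn_coordVec {T : ∀ q : M, TangentSpace (𝓡 n) q}
    (hT : ContMDiff (𝓡 n) (𝓡 n).tangent ∞ (fun q => (⟨q, T q⟩ : TangentBundle (𝓡 n) M)))
    (p : M) :
    ContDiffOn ℝ ∞ (fun x => coordVec p ((extChartAt (𝓡 n) p).symm x)
      (T ((extChartAt (𝓡 n) p).symm x))) (extChartAt (𝓡 n) p).target := by
  have : IsManifold (𝓡 n) 1 M := IsManifold.of_le (n := ∞) (by simp)
  let t := trivializationAt (EuclideanSpace ℝ (Fin n)) (TangentSpace (𝓡 n)) p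
  have hcoordVec : ∀ q ∈ t.baseSet, coordVec p q (T q) = (t ⟨q, T q⟩).2 := fun q hq => by
    have hq' : q ∈ (chartAt (EuclideanSpace ℝ (Fin n)) p).source := by simpa [t] using hq
    have ht : t.continuousLinearMapAt ℝ q (T q) = (t ⟨q, T q⟩).2 := by
      rw [Bundle.Trivialization.continuousLinearMapAt_apply,
        Bundle.Trivialization.linearMapAt_apply, if_pos hq]
    exact (DFunLike.congr_fun
      (TangentBundle.continuousLinearMapAt_trivializationAt hq') (T q)).symm.trans ht
  rw [← contMDiffOn_iff_contDiffOn]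
  refine (((t.contMDiffOn_section_baseSet_iff (IB := 𝓡 n) (n := ∞) (s := T)).1
    hT.contMDiffOn).congr hcoordVec).comp (contMDiffOn_extChartAt_symm p) fun x hx => ?_
  simpa [t] using (extChartAt (𝓡 n) p).map_target hx

theorem exists_mem_coordVec_eq {p q : M} (hq : q ∈ (chartAt (EuclideanSpace ℝ (Fin n)) p).source)
    {D : Submodule ℝ (TangentSpace (𝓡 n) q)} (hD : Module.finrank ℝ D + 1 = n)
    {η : EuclideanSpace ℝ (Fin n) →L[ℝ] ℝ} (hη : η ≠ 0) (hηD : ∀ v ∈ D, η (coordVec p q v) = 0)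
    {w : EuclideanSpace ℝ (Fin n)} (hw : η w = 0) : ∃ v ∈ D, coordVec p q v = w := by
  have : IsManifold (𝓡 n) 1 M := IsManifold.of_le (n := ∞) (by simp)
  have hinj : Function.Injective (coordVec p q) :=
    (isInvertible_mfderiv_extChartAt (I := 𝓡 n) (by rwa [extChartAt_source])).injective
  let A : TangentSpace (𝓡 n) q →ₗ[ℝ] EuclideanSpace ℝ (Fin n) :=
    (mfderiv (𝓡 n) 𝓘(ℝ, EuclideanSpace ℝ (Fin n)) (extChartAt (𝓡 n) p) q).toLinearMap
  have hmap := map_eq_ker_of_finrank_add_one (A := A) (η := η.toLinearMap) hinj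
    (fun h => hη (ContinuousLinearMap.coe_injective h)) hηD
    (by rw [hD, finrank_euclideanSpace_fin])
  exact hmap.ge hw

theorem isPrincipalField_coord {F : Type*} [NormedAddCommGroup F] [NormedSpace ℝ F]
    {ε : ℝ} {ψ : M → F} (hψ : IsConvexCentroaffine (n := n) ε ψ) (hn : 1 ≤ n)
    {T : ∀ q : M, TangentSpace (𝓡 n) q}
    (hT : ContMDiff (𝓡 n) (𝓡 n).tangent ∞ (fun q => (⟨q, T q⟩ : TangentBundle (𝓡 n) M)))
    {D₂ : ∀ q : M, Submodule ℝ (TangentSpace (𝓡 n) q)}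
    (hD₂ : ∀ q, Module.finrank ℝ (D₂ q) = n - 1)
    {lam₁ lam₂ : M → ℝ} (hlam : ∀ q, lam₁ q ≠ 2 * lam₂ q) (p : M)
    (hunit : ∀ q ∈ (chartAt (EuclideanSpace ℝ (Fin n)) p).source,
      metricAt ε ψ p q (T q) (T q) = 1)
    (horth : ∀ q ∈ (chartAt (EuclideanSpace ℝ (Fin n)) p).source, ∀ v ∈ D₂ q,
      metricAt ε ψ p q (T q) v = 0)
    (hKT : ∀ q ∈ (chartAt (EuclideanSpace ℝ (Fin n)) p).source,
      diffTensorAt ε ψ p q (T q) (T q) = lam₁ q • coordVec p q (T q))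
    (hKV : ∀ q ∈ (chartAt (EuclideanSpace ℝ (Fin n)) p).source, ∀ v ∈ D₂ q,
      diffTensorAt ε ψ p q (T q) v = lam₂ q • coordVec p q v) :
    IsPrincipalField ε (coordRep ψ p) (extChartAt (𝓡 n) p).target
      (fun x => coordVec p ((extChartAt (𝓡 n) p).symm x) (T ((extChartAt (𝓡 n) p).symm x)))
      (fun x => lam₁ ((extChartAt (𝓡 n) p).symm x))
      (fun x => lam₂ ((extChartAt (𝓡 n) p).symm x)) := by
  have hsource : ∀ x ∈ (extChartAt (𝓡 n) p).target,
      (extChartAt (𝓡 n) p).symm x ∈ (chartAt (EuclideanSpace ℝ (Fin n)) p).source :=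
    fun x hx => by simpa using (extChartAt (𝓡 n) p).map_target hx
  have hunit' := fun x hx => (metricAt_extChartAt_symm ε ψ p hx _ _).symm.trans
    (hunit _ (hsource x hx))
  refine ⟨hψ.2 p, isOpen_extChartAt_target p, contDiffOn_coordVec hT p, hunit', fun x hx => ?_,
    fun x hx w hw => ?_, fun x _ => hlam _⟩
  · rw [← diffTensorAt_extChartAt_symm ε ψ p hx, hKT _ (hsource x hx)]
  · have hη : metric ε (coordRep ψ p) x (coordVec p _ (T ((extChartAt (𝓡 n) p).symm x))) ≠ 0 :=
      fun h0 => one_ne_zero ((hunit' x hx).symm.trans (DFunLike.congr_fun h0 _))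
    obtain ⟨v, hv, rfl⟩ := exists_mem_coordVec_eq (hsource x hx) (by rw [hD₂]; omega) hη
      (fun v hv => (metricAt_extChartAt_symm ε ψ p hx _ v).symm.trans (horth _ (hsource x hx) v hv))
      hw
    rw [← diffTensorAt_extChartAt_symm ε ψ p hx, hKV _ (hsource x hx) v hv]

end Manifold

end Centroaffine

theorem theorem3p4 {n : ℕ} (hn : 2 ≤ n)
    {M : Type*} [TopologicalSpace M] [ChartedSpace (EuclideanSpace ℝ (Fin n)) M]
    [IsManifold (𝓡 n) ∞ M]
    (ε : ℝ) (ψ : M → EuclideanSpace ℝ (Fin (n + 1)))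
    (hψ : Centroaffine.IsConvexCentroaffine (n := n) ε ψ)
    (hK : Centroaffine.HasParallelDiffTensor (n := n) ε ψ)
    (T : ∀ q : M, TangentSpace (𝓡 n) q)
    (hT : ContMDiff (𝓡 n) (𝓡 n).tangent ∞ (fun q => (⟨q, T q⟩ : TangentBundle (𝓡 n) M)))
    (D₂ : ∀ q : M, Submodule ℝ (TangentSpace (𝓡 n) q))
    (hD₂ : ∀ q, Module.finrank ℝ (D₂ q) = n - 1)
    (lam₁ lam₂ : M → ℝ)
    (hlam : ∀ q, lam₁ q ≠ 2 * lam₂ q)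
    (hunit : ∀ p : M, ∀ q ∈ (chartAt (EuclideanSpace ℝ (Fin n)) p).source,
      Centroaffine.metricAt (n := n) ε ψ p q (T q) (T q) = 1)
    (horth : ∀ p : M, ∀ q ∈ (chartAt (EuclideanSpace ℝ (Fin n)) p).source, ∀ v ∈ D₂ q,
      Centroaffine.metricAt (n := n) ε ψ p q (T q) v = 0)
    (hKT : ∀ p : M, ∀ q ∈ (chartAt (EuclideanSpace ℝ (Fin n)) p).source,
      Centroaffine.diffTensorAt (n := n) ε ψ p q (T q) (T q) = lam₁ q • Centroaffine.coordVec (n := n) p q (T q))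
    (hKV : ∀ p : M, ∀ q ∈ (chartAt (EuclideanSpace ℝ (Fin n)) p).source, ∀ v ∈ D₂ q,
      Centroaffine.diffTensorAt (n := n) ε ψ p q (T q) v = lam₂ q • Centroaffine.coordVec (n := n) p q v) :
    ∀ p₀ : M, Centroaffine.IsCalabiProductWithPointNear ψ p₀ := by
  intro p₀
  obtain ⟨R, hR, hball⟩ := Metric.isOpen_iff.1 (isOpen_extChartAt_target (I := 𝓡 n) p₀) _
    (mem_extChartAt_target (I := 𝓡 n) p₀)
  have hx₀ : extChartAt (𝓡 n) p₀ p₀ ∈ Metric.ball (extChartAt (𝓡 n) p₀ p₀) R :=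
    Metric.mem_ball_self hR
  have hdim : 2 ≤ Module.finrank ℝ (EuclideanSpace ℝ (Fin n)) := by
    rwa [finrank_euclideanSpace_fin]
  have hpar : Centroaffine.HasParallelDiffTensorOn ε (Centroaffine.coordRep ψ p₀)
      (Metric.ball (extChartAt (𝓡 n) p₀ p₀) R) := fun x hx => hK p₀ x (hball hx)
  obtain ⟨a, b, hab⟩ := ((Centroaffine.isPrincipalField_coord hψ (by omega) hT hD₂ hlam p₀
    (hunit p₀) (horth p₀) (hKT p₀) (hKV p₀)).mono Metric.isOpen_ball hball).exists_const hpar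
    (convex_ball _ R).isPreconnected hdim
  obtain ⟨c, ε₁, r, V, ψ₁, A, Φ, hmem, hsub, hΦ⟩ := hab.exists_isCalabiDecomposition
    (E₁ := EuclideanSpace ℝ (Fin (n - 1))) (F₁ := EuclideanSpace ℝ (Fin n)) hpar
    (hab.eps_eq hpar hdim hx₀) (by simp only [finrank_euclideanSpace_fin]; omega)
    (by simp only [finrank_euclideanSpace_fin]) hx₀
  exact hΦ.isCalabiProductWithPointNear (hsub.trans hball) hmem
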